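/- **Setting.** Let $X$ be a compact metric space, $\mu$ a Borel probability measure on $X$ and $T:X\to X$ an invertible, bi-measurable map preserving $\mu$. For each integer $N\ge 1$ let $U_N$ be a unitary $N\times N$ matrix, let $\Theta_N(A)=U_N^*AU_N$ be the corresponding automorphism of the matrix algebra $\mathcal M_N=M_N(\mathbb C)$, and let $\tau_N=\frac1N\operatorname{tr}$. Let $C_N(x)\in\mathbb C^N$ ($x\in X$) be a family of coherent states, i.e. 1. $x\mapsto C_N(x)$ is measurable; 2. $\|C_N(x)\|=1$ for all $x$; 3. $N\int_X |C_N(x)\rangle\langle C_N(x)|\,d\mu(x)=\mathbf 1$; 4. for all $\varepsilon,d_0>0$ there is $N_0$ such that $N|\langle C_N(x),C_N(y)\rangle|^2\le\varepsilon$ whenever $N\ge N_0$ and $d(x,y)\ge d_0$. Assume the *dynamical localization condition*: there is $\alpha_0>0$ such that for all $\varepsilon,d_0>0$ there is $N_0\in\mathbb N$ such that for all $N>N_0$, all integers $0\le k\le\alpha_0\log N$ and all $x,y\in X$ with $d(T^kx,y)\ge d_0$ one has $N|\langle U_N^kC_N(x),C_N(y)\rangle|^2\le\varepsilon$. Let $\gamma_{N\infty}:L^\infty_\mu(X)\to\mathcal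 M_N$, $\gamma_{N\infty}(f)=N\int_X f(x)\,|C_N(x)\rangle\langle C_N(x)|\,d\mu(x)$, be the anti-Wick quantization map. **The $k$-subalgebra functional.** Put $\eta(t)=-t\log t$, $\eta(0)=0$. For a state $\omega$ on a $*$-algebra $\mathcal M$ and completely positive unital maps $\gamma_0,\dots,\gamma_{k-1}$ from a finite-dimensional $C^*$-algebra $\mathcal N$ to $\mathcal M$ let $$H_\omega(\gamma_0,\dots,\gamma_{k-1})=\sup\Big\{\sum_{\mathbf i}\eta(\mu_{\mathbf i})-\sum_{\ell=0}^{k-1}\sum_{j\in I_\ell}\eta(\mu^\ell_j)+\sum_{\ell=0}^{k-1}\Big(S(\omega\circ\gamma_\ell)-\sum_{j\in I_\ell}\mu^\ell_j\,S(\omega^\ell_j\circ\gamma_\ell)\Big)\Big\},$$ where the supremum is over all finite index sets $I_0,\dots,I_{k-1}$ and all decompositions $\omega=\sum_{\mathbf i}\mu_{\mathbf i}\omega_{\mathbf i}$, $\mathbf i\in I_0\times\dots\times I_{k-1}$, into states $\omega_{\mathbf i}$ with weights $\mu_{\mathbf i}\ge0$, $\sum_{\mathbf i}\mu_{\mathbf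 i}=1$; here $\mu^\ell_j=\sum_{\mathbf i:\,i_\ell=j}\mu_{\mathbf i}$, $\omega^\ell_j=\sum_{\mathbf i:\,i_\ell=j}(\mu_{\mathbf i}/\mu^\ell_j)\,\omega_{\mathbf i}$ (terms with $\mu^\ell_j=0$ are zero), and $S$ is the von Neumann entropy of a state on $\mathcal N$. **Theorem.** Let $\mathcal C=\{C_0,\dots,C_{q-1}\}$ be a finite measurable partition of $X$, let $\mathcal N_{\mathcal C}\subset L^\infty_\mu(X)$ be the finite-dimensional subalgebra generated by the characteristic functions $\chi_{C_j}$, with inclusion $\imath_{\mathcal N_{\mathcal C}}$, and put $$\gamma^\ell_{\mathcal C}=\Theta_N^\ell\circ\gamma_{N\infty}\circ\imath_{\mathcal N_{\mathcal C}}:\mathcal N_{\mathcal C}\to\mathcal M_N .$$ Let $S_\mu(\mathcal C^{(k)})=\sum_{\mathbf i\in\{0,\dots,q-1\}^k}\eta\big(\mu\big(\bigcap_{\ell=0}^{k-1}T^{-\ell}(C_{i_\ell})\big)\big)$ be the entropy of the refined partition. Then there is $\alpha>0$ such that $$\lim_{\substack{k,N\to\infty\\ k\le\alpha\log N}}\frac1k\Big|H_{\tau_N}(\gamma^0_{\mathcal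 C},\gamma^1_{\mathcal C},\dots,\gamma^{k-1}_{\mathcal C})-S_\mu(\mathcal C^{(k)})\Big|=0 .$$ That is, for every $\varepsilon>0$ there are $k_0,N_0$ such that the expression is less than $\varepsilon$ for all $k\ge k_0$ and $N\ge N_0$ with $k\le\alpha\log N$. -/

import Mathlib

open MeasureTheory Filter Topology
open scoped ENNReal ComplexOrder Matrix

namespace CNT

noncomputable section

/-! ## The `*`-algebra `L^∞(μ)` of essentially bounded complex functions

Mathlib provides the star operation and the complex vector space structure on `Lp ℂ ∞ μ`;
the pointwise a.e. product and the unit are added here. -/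

section LInfty

variable {X : Type*} [MeasurableSpace X] {μ : Measure X}

instance instMulLInfty : Mul (Lp ℂ ∞ μ) where
  mul f g := (((Lp.memLp g).mul (Lp.memLp f) : MemLp (⇑f * ⇑g) ∞ μ)).toLp (⇑f * ⇑g)

instance instOneLInfty : One (Lp ℂ ∞ μ) where
  one := (memLp_top_const (1 : ℂ)).toLp (fun _ => (1 : ℂ))

theorem coeFn_mul (f g : Lp ℂ ∞ μ) : ⇑(f * g) =ᵐ[μ] fun x => f x * g x :=
  MemLp.coeFn_toLp _

theorem coeFn_one : ⇑(1 : Lp ℂ ∞ μ) =ᵐ[μ] fun _ => (1 : ℂ) :=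
  MemLp.coeFn_toLp _

theorem coeFn_starLp (f : Lp ℂ ∞ μ) : ⇑(star f) =ᵐ[μ] fun x => star (f x) :=
  AEEqFun.coeFn_star _

theorem mul_comm_aux (f g : Lp ℂ ∞ μ) : f * g = g * f := by
  refine Lp.ext ?_
  filter_upwards [coeFn_mul f g, coeFn_mul g f] with x h1 h2
  rw [h1, h2, mul_comm]

theorem mul_add_aux (f g h : Lp ℂ ∞ μ) : f * (g + h) = f * g + f * h := by
  refine Lp.ext ?_
  filter_upwards [coeFn_mul f (g + h), coeFn_mul f g, coeFn_mul f h, Lp.coeFn_add g h,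
    Lp.coeFn_add (f * g) (f * h)] with x h1 h2 h3 h4 h5
  simp only [h1, h2, h3, h4, h5, Pi.add_apply, mul_add]

theorem one_mul_aux (f : Lp ℂ ∞ μ) : 1 * f = f := by
  refine Lp.ext ?_
  filter_upwards [coeFn_mul 1 f, coeFn_one (μ := μ)] with x h1 h2
  rw [h1, h2, one_mul]

theorem mul_assoc_aux (f g h : Lp ℂ ∞ μ) : f * g * h = f * (g * h) := by
  refine Lp.ext ?_
  filter_upwards [coeFn_mul (f * g) h, coeFn_mul f g, coeFn_mul f (g * h), coeFn_mul g h]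
    with x h1 h2 h3 h4
  rw [h1, h2, h3, h4, mul_assoc]

theorem zero_mul_aux (f : Lp ℂ ∞ μ) : 0 * f = 0 := by
  refine Lp.ext ?_
  filter_upwards [coeFn_mul 0 f, Lp.coeFn_zero ℂ ∞ μ] with x h1 h2
  rw [h1, h2, Pi.zero_apply, zero_mul]

instance instCommRingLInfty : CommRing (Lp ℂ ∞ μ) where
  __ := (inferInstance : AddCommGroup (Lp ℂ ∞ μ))
  mul_assoc := mul_assoc_aux
  one_mul := one_mul_aux
  mul_one f := by rw [mul_comm_aux, one_mul_aux]
  left_distrib := mul_add_aux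
  right_distrib f g h := by
    rw [mul_comm_aux, mul_add_aux, mul_comm_aux h f, mul_comm_aux h g]
  zero_mul := zero_mul_aux
  mul_zero f := by rw [mul_comm_aux, zero_mul_aux]
  mul_comm := mul_comm_aux

theorem smul_mul_aux (c : ℂ) (f g : Lp ℂ ∞ μ) : c • f * g = c • (f * g) := by
  refine Lp.ext ?_
  filter_upwards [coeFn_mul (c • f) g, coeFn_mul f g, Lp.coeFn_smul c f,
    Lp.coeFn_smul c (f * g)] with x h1 h2 h3 h4
  simp only [h1, h2, h3, h4, Pi.smul_apply, smul_eq_mul, mul_assoc]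

instance instAlgebraLInfty : Algebra ℂ (Lp ℂ ∞ μ) :=
  Algebra.ofModule smul_mul_aux fun c f g => by
    rw [mul_comm f (c • g), smul_mul_aux, mul_comm g f]

instance instStarRingLInfty : StarRing (Lp ℂ ∞ μ) where
  star_involutive := star_involutive
  star_mul f g := by
    refine Lp.ext ?_
    filter_upwards [coeFn_starLp (f * g), coeFn_mul f g, coeFn_starLp f, coeFn_starLp g,
      coeFn_mul (star g) (star f)] with x h1 h2 h3 h4 h5
    rw [h1, h2, h5, h3, h4, star_mul]
  star_add f g := by
    refine Lp.ext ?_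
    filter_upwards [coeFn_starLp (f + g), Lp.coeFn_add f g, coeFn_starLp f, coeFn_starLp g,
      Lp.coeFn_add (star f) (star g)] with x h1 h2 h3 h4 h5
    simp only [h1, h2, h5, h3, h4, Pi.add_apply, star_add]

instance instStarModuleLInfty : StarModule ℂ (Lp ℂ ∞ μ) where
  star_smul c f := by
    refine Lp.ext ?_
    filter_upwards [coeFn_starLp (c • f), Lp.coeFn_smul c f, coeFn_starLp f,
      Lp.coeFn_smul (star c) (star f)] with x h1 h2 h3 h4
    simp only [h1, h2, h3, h4, Pi.smul_apply, star_smul]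

end LInfty

/-! ## Quantum dynamical systems in dimension `N` -/

/-- The normalized trace `τ_N` on `N × N` matrices. -/
def normalizedTrace (N : ℕ+) : Matrix (Fin N) (Fin N) ℂ →ₗ[ℂ] ℂ :=
  ((N : ℕ) : ℂ)⁻¹ • Matrix.traceLinearMap (Fin N) ℂ ℂ

/-- The discrete time quantum dynamics `Θ_N(X) = U* X U`. -/
def quantumDynamics {N : ℕ+} (U : Matrix.unitaryGroup (Fin N) ℂ) :
    Matrix (Fin N) (Fin N) ℂ ≃⋆ₐ[ℂ] Matrix (Fin N) (Fin N) ℂ :=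
  (Unitary.conjStarAlgAut ℂ (Matrix (Fin N) (Fin N) ℂ) U).symm

theorem quantumDynamics_apply {N : ℕ+} (U : Matrix.unitaryGroup (Fin N) ℂ)
    (x : Matrix (Fin N) (Fin N) ℂ) :
    quantumDynamics U x = (U : Matrix (Fin N) (Fin N) ℂ)ᴴ * x * (U : Matrix (Fin N) (Fin N) ℂ) :=
  rfl

/-! ## Coherent states and anti-Wick quantization -/

section Coherent

variable {X : Type*}

/-- The matrix `|v⟩⟨v|`. -/
def ketBra {N : ℕ+} (v : EuclideanSpace ℂ (Fin N)) : Matrix (Fin N) (Fin N) ℂ :=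
  Matrix.of fun i j => v i * star (v j)

/-- A family of coherent states `C_N(x) ∈ ℂ^N`, `x ∈ X`, `N ≥ 1`. Overcompleteness,
`N ∫ |C_N(x)⟩⟨C_N(x)| dμ(x) = 1`, is the equality of all matrix entries. -/
structure CoherentStates [MetricSpace X] [MeasurableSpace X] (μ : Measure X) where
  vec : (N : ℕ+) → X → EuclideanSpace ℂ (Fin N)
  measurable : ∀ N, Measurable (vec N)
  normalized : ∀ N x, ‖vec N x‖ = 1
  overcomplete : ∀ (N : ℕ+) (i j : Fin N),
    ((N : ℕ) : ℂ) * ∫ x, ketBra (vec N x) i j ∂μ = (1 : Matrix (Fin N) (Fin N) ℂ) i j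
  localized : ∀ ε > (0 : ℝ), ∀ d₀ > (0 : ℝ), ∃ N₀ : ℕ, ∀ N : ℕ+, N₀ ≤ (N : ℕ) →
    ∀ x y, d₀ ≤ dist x y → ((N : ℕ) : ℝ) * ‖inner ℂ (vec N x) (vec N y)‖ ^ 2 ≤ ε

/-- Dynamical localization of the coherent states `C` for the classical map `T` and the one-step
quantum evolutions `U N`. -/
def DynamicalLocalization [MetricSpace X] [MeasurableSpace X] {μ : Measure X} (T : X → X)
    (C : CoherentStates μ) (U : (N : ℕ+) → Matrix.unitaryGroup (Fin N) ℂ) : Prop :=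
  ∃ α > (0 : ℝ), ∀ ε > (0 : ℝ), ∀ d₀ > (0 : ℝ), ∃ N₀ : ℕ, ∀ N : ℕ+, N₀ < (N : ℕ) →
    ∀ k : ℕ, (k : ℝ) ≤ α * Real.log (N : ℕ) → ∀ x y, d₀ ≤ dist (T^[k] x) y →
      ((N : ℕ) : ℝ) * ‖inner ℂ
        (Matrix.toEuclideanLin ((U N : Matrix (Fin N) (Fin N) ℂ) ^ k) (C.vec N x))
        (C.vec N y)‖ ^ 2 ≤ ε

variable [MetricSpace X] [MeasurableSpace X] {μ : Measure X}

theorem integrable_mul_ketBra [IsFiniteMeasure μ] (C : CoherentStates μ) (N : ℕ+)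
    (f : Lp ℂ ∞ μ) (i j : Fin N) : Integrable (fun x => f x * ketBra (C.vec N x) i j) μ := by
  have hm : ∀ l : Fin N, Measurable fun x => C.vec N x l := fun l =>
    (EuclideanSpace.proj (𝕜 := ℂ) l).continuous.measurable.comp (C.measurable N)
  have hf : Integrable f μ := (Lp.memLp f).integrable le_top
  have hb : ∀ (l : Fin N) x, ‖C.vec N x l‖ ≤ 1 := fun l x =>
    (PiLp.norm_apply_le (C.vec N x) l).trans_eq (C.normalized N x)
  refine hf.mul_bdd (c := 1) ?_ (ae_of_all _ fun x => ?_)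
  · exact ((hm i).mul (continuous_star.measurable.comp (hm j))).aestronglyMeasurable
  · simp only [ketBra, Matrix.of_apply, norm_mul, norm_star]
    exact mul_le_one₀ (hb i x) (norm_nonneg _) (hb j x)

/-- Anti-Wick quantization `γ_{N∞}(f) = N ∫ f(x) |C_N(x)⟩⟨C_N(x)| dμ(x)`. -/
def antiWick [IsFiniteMeasure μ] (C : CoherentStates μ) (N : ℕ+) :
    Lp ℂ ∞ μ →ₗ[ℂ] Matrix (Fin N) (Fin N) ℂ where
  toFun f := Matrix.of fun i j => ((N : ℕ) : ℂ) * ∫ x, f x * ketBra (C.vec N x) i j ∂μ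
  map_add' f g := by
    ext i j
    simp only [Matrix.of_apply, Matrix.add_apply]
    rw [← mul_add, ← integral_add (integrable_mul_ketBra C N f i j)
      (integrable_mul_ketBra C N g i j)]
    congr 1
    refine integral_congr_ae ?_
    filter_upwards [Lp.coeFn_add f g] with x hx
    rw [hx, Pi.add_apply, add_mul]
  map_smul' c f := by
    ext i j
    simp only [Matrix.of_apply, Matrix.smul_apply, RingHom.id_apply, smul_eq_mul]
    rw [mul_left_comm]
    congr 1
    rw [← MeasureTheory.integral_const_mul]
    refine integral_congr_ae ?_
    filter_upwards [Lp.coeFn_smul c f] with x hx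
    rw [hx, Pi.smul_apply, smul_eq_mul, mul_assoc]

end Coherent

/-! ## States, von Neumann entropy and the `k`-subalgebra functional -/

section Entropy

variable {A M : Type*} [Ring A] [StarRing A] [Algebra ℂ A] [Ring M] [StarRing M] [Algebra ℂ M]

/-- A state: a positive linear functional with value one at the unit. -/
structure IsState (φ : M →ₗ[ℂ] ℂ) : Prop where
  nonneg : ∀ x, 0 ≤ φ (star x * x)
  map_one : φ 1 = 1

/-- `p` resolves the density matrix of the functional `φ` on the finite dimensional C*-algebra `A`
spectrally: the `p i` are mutually orthogonal minimal projections with sum one, and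
`φ(x) = ∑ i, φ(p i * x * p i)`. The latter means that the density matrix of `φ` is
`∑ i, φ(p i) • p i`, so its eigenvalues, counted with multiplicity, are the numbers `φ(p i)`. -/
structure IsSpectralResolution (φ : A →ₗ[ℂ] ℂ) {d : ℕ} (p : Fin d → A) : Prop where
  proj : ∀ i, IsStarProjection (p i)
  ne_zero : ∀ i, p i ≠ 0
  minimal : ∀ i x, ∃ c : ℂ, p i * x * p i = c • p i
  orthogonal : ∀ i j, i ≠ j → p i * p j = 0
  sum_eq_one : ∑ i, p i = 1
  diagonal : ∀ x, φ x = ∑ i, φ (p i * x * p i)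

/-- The von Neumann entropy `-∑ λ log λ` of a positive functional on a finite dimensional
C*-algebra, `λ` running through the eigenvalues of its density matrix. All spectral resolutions
give the same value, so that the infimum is over a set with one element. -/
def vonNeumannEntropy (φ : A →ₗ[ℂ] ℂ) : ℝ :=
  sInf {s : ℝ | ∃ (d : ℕ) (p : Fin d → A), IsSpectralResolution φ p ∧
    s = ∑ i, Real.negMulLog (φ (p i)).re}

/-- A decomposition `ω = ∑ i, μ_i ω_i` of `ω` into states, labelled by multi-indices
`i = (i_0, …, i_{k-1})` in a product `I_0 × ⋯ × I_{k-1}` of finite index sets. -/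
structure StateDecomposition (ω : M →ₗ[ℂ] ℂ) (k : ℕ) where
  card : Fin k → ℕ
  weight : ((l : Fin k) → Fin (card l)) → ℝ
  state : ((l : Fin k) → Fin (card l)) → M →ₗ[ℂ] ℂ
  weight_nonneg : ∀ i, 0 ≤ weight i
  sum_weight : ∑ i, weight i = 1
  isState : ∀ i, IsState (state i)
  decomp : ω = ∑ i, (weight i : ℂ) • state i

namespace StateDecomposition

variable {ω : M →ₗ[ℂ] ℂ} {k : ℕ} (D : StateDecomposition ω k)

/-- The weight `μ^l_j = ∑_{i : i_l = j} μ_i` of the `l`-th subdecomposition. -/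
def subWeight (l : Fin k) (j : Fin (D.card l)) : ℝ :=
  ∑ i with i l = j, D.weight i

/-- The state `ω^l_j = ∑_{i : i_l = j} (μ_i / μ^l_j) ω_i` of the `l`-th subdecomposition
(zero if its weight vanishes). -/
def subState (l : Fin k) (j : Fin (D.card l)) : M →ₗ[ℂ] ℂ :=
  ∑ i with i l = j, ((D.weight i / D.subWeight l j : ℝ) : ℂ) • D.state i

/-- The quantity maximized in the definition of the `k`-subalgebra functional. -/
def value (γ : Fin k → A →ₗ[ℂ] M) : ℝ :=
  ∑ i, Real.negMulLog (D.weight i) - ∑ l, ∑ j, Real.negMulLog (D.subWeight l j)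
    + ∑ l, (vonNeumannEntropy (ω ∘ₗ γ l)
        - ∑ j, D.subWeight l j * vonNeumannEntropy (D.subState l j ∘ₗ γ l))

end StateDecomposition

/-- The Connes--Narnhofer--Thirring `k`-subalgebra functional `H_ω(γ_0, …, γ_{k-1})`. -/
def subalgebraFunctional (ω : M →ₗ[ℂ] ℂ) {k : ℕ} (γ : Fin k → A →ₗ[ℂ] M) : ℝ :=
  ⨆ D : StateDecomposition ω k, D.value γ

end Entropy

/-! ## Partitions -/

section Partition

variable {X : Type*} [MeasurableSpace X]

/-- A finite partition of `X` into measurable sets. -/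
structure IsMeasurablePartition {q : ℕ} (P : Fin q → Set X) : Prop where
  measurableSet : ∀ i, MeasurableSet (P i)
  disjoint : ∀ i j, i ≠ j → Disjoint (P i) (P j)
  iUnion_eq : ⋃ i, P i = Set.univ

/-- The entropy `S_μ` of the refined partition with atoms `⋂ l < k, T^{-l}(P_{i_l})`. -/
def refinedEntropy (μ : Measure X) (T : X → X) {q : ℕ} (P : Fin q → Set X) (k : ℕ) : ℝ :=
  ∑ i : Fin k → Fin q, Real.negMulLog (μ.real (⋂ l : Fin k, T^[l] ⁻¹' P (i l)))

variable {μ : Measure X} [IsFiniteMeasure μ]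

/-- The class in `L^∞(μ)` of the characteristic function of a measurable set. -/
def charFn {s : Set X} (hs : MeasurableSet s) : Lp ℂ ∞ μ :=
  indicatorConstLp ∞ hs (measure_ne_top μ s) 1

/-- The subalgebra of `L^∞(μ)` generated by the characteristic functions of the atoms. -/
def partitionAlgebra (μ : Measure X) [IsFiniteMeasure μ] {q : ℕ} {P : Fin q → Set X}
    (hP : IsMeasurablePartition P) : StarSubalgebra ℂ (Lp ℂ ∞ μ) :=
  StarAlgebra.adjoin ℂ (Set.range fun j => charFn (μ := μ) (hP.measurableSet j))

/-- The map `Θ_N^l ∘ γ_{N∞} ∘ ι` from the algebra of the partition to `N × N` matrices. -/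
def quantizedPartition [MetricSpace X] (C : CoherentStates μ)
    (U : (N : ℕ+) → Matrix.unitaryGroup (Fin N) ℂ) {q : ℕ} {P : Fin q → Set X}
    (hP : IsMeasurablePartition P) (N : ℕ+) (l : ℕ) :
    partitionAlgebra μ hP →ₗ[ℂ] Matrix (Fin N) (Fin N) ℂ :=
  ((quantumDynamics (U N) ^ l).toAlgEquiv.toLinearMap ∘ₗ antiWick C N) ∘ₗ
    (partitionAlgebra μ hP).subtype.toAlgHom.toLinearMap

end Partition

end

end CNT

/-!
The functional is squeezed between two entropies of classical probability distributions.

Since the algebra of the partition is abelian, the von Neumann entropies in the functional are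
Shannon entropies (`vonNeumannEntropy_partitionAlgebra`). For a decomposition with random index
`A = (A_l)` and for the outcome `B_l` of the POVM `E_l`, the image of the atoms of the partition
under the `l`-th quantized map, the value of the decomposition is `H(A) - ∑ l, H(A_l | B_l)`.

*Egorov property.* Let `F(S)` be the quantization of the characteristic function of `S`. Dynamical
localization, applied on closed subsets of `S` and of its complement, gives
`τ(F(T⁻ˡ S) Θˡ(F(S))) ≥ μ(S) - δ` uniformly in `l ≤ α log N`
(`exists_forall_le_normalizedTrace_mul_evolvedMeasure`). Because `0 ≤ F ≤ 1`, the second moments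
`τ(F(T⁻ˡ S)²)` and `τ(Θˡ(F(S))²)` are at most `μ(S)`, so that `Θˡ(F(S))` and `F(T⁻ˡ S)` are close
in the Hilbert–Schmidt norm of `τ`.

*Upper bound.* The quantized atoms of the refined partition form one POVM whose `l`-th marginal is
`F(T⁻ˡ P_m)`. If the `E_l` were these marginals, all `B_l` would be defined on a common probability
space with `A`, and `H(A) ≤ H(A, B) ≤ H(B) + ∑ l, H(A_l | B_l)` (`entropy_le`) would bound every
value by the classical entropy `H(B)`. The actual `E_l` are close to the marginals, and the error
per step is uniform over all decompositions by the Cauchy–Schwarz inequality for states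
(`StateDecomposition.value_le`).

*Lower bound.* The decomposition `τ = ∑ b, τ(Y_b ·)` along the quantized atoms `Y_b` of the refined
partition has index entropy equal to the classical entropy, and by the Egorov property its `l`-th
index nearly determines `B_l` (`StateDecomposition.le_value`).

Both errors are a small constant times `k`, which proves the limit with the rate `α` of the
localization condition.
-/

namespace CNT

/-! ### Entropy inequalities for finite distributions -/

/-- Uniform continuity of `-t log t` on `[0, 1]`, with a quadratic majorant of the modulus: the
quadratic form of the error is what the Cauchy–Schwarz inequality for states controls. -/
theorem exists_abs_negMulLog_sub_le {ε : ℝ} (hε : 0 < ε) :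
    ∃ K : ℝ, 0 ≤ K ∧ ∀ s ∈ Set.Icc (0 : ℝ) 1, ∀ t ∈ Set.Icc (0 : ℝ) 1,
      |Real.negMulLog s - Real.negMulLog t| ≤ ε + K * (s - t) ^ 2 := by
  have huc : UniformContinuousOn Real.negMulLog (Set.Icc 0 1) :=
    isCompact_Icc.uniformContinuousOn_of_continuous Real.continuous_negMulLog.continuousOn
  obtain ⟨δ, hδ, h⟩ := Metric.uniformContinuousOn_iff.1 huc ε hε
  have hbd : ∀ s ∈ Set.Icc (0 : ℝ) 1, Real.negMulLog s ∈ Set.Icc (0 : ℝ) 1 := by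
    rintro s ⟨h0, h1⟩
    refine ⟨Real.negMulLog_nonneg h0 h1, ?_⟩
    rcases h0.eq_or_lt with rfl | h0
    · simp
    · have h2 := mul_le_mul_of_nonneg_left (Real.one_sub_inv_le_log_of_pos h0) h0.le
      rw [mul_sub, mul_inv_cancel₀ h0.ne'] at h2
      rw [Real.negMulLog]
      linarith
  refine ⟨(δ ^ 2)⁻¹, by positivity, fun s hs t ht => ?_⟩
  rcases lt_or_ge (dist s t) δ with hd | hd
  · have h1 := h s hs t ht hd
    rw [Real.dist_eq] at h1
    have h2 : 0 ≤ (δ ^ 2)⁻¹ * (s - t) ^ 2 := by positivity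
    linarith
  · have h1 : |Real.negMulLog s - Real.negMulLog t| ≤ 1 := by
      obtain ⟨h3, h4⟩ := hbd s hs
      obtain ⟨h5, h6⟩ := hbd t ht
      rw [abs_le]
      constructor <;> linarith
    have h2 : 1 ≤ (δ ^ 2)⁻¹ * (s - t) ^ 2 := by
      rw [inv_mul_eq_div, one_le_div (by positivity), ← sq_abs (s - t)]
      rw [Real.dist_eq] at hd
      gcongr
    linarith

theorem negMulLog_sum_le {ι : Type*} (s : Finset ι) (p : ι → ℝ) (hp : ∀ i ∈ s, 0 ≤ p i) :
    Real.negMulLog (∑ i ∈ s, p i) ≤ ∑ i ∈ s, Real.negMulLog (p i) := by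
  rw [Real.negMulLog, ← Finset.sum_neg_distrib, Finset.sum_mul]
  refine Finset.sum_le_sum fun i hi => ?_
  rcases (hp i hi).eq_or_lt with h | h
  · simp [← h]
  · have h1 : Real.log (p i) ≤ Real.log (∑ i ∈ s, p i) :=
      Real.log_le_log h (Finset.single_le_sum hp hi)
    rw [Real.negMulLog]
    nlinarith

/-- The chain rule `H(J, M) = H(J) + H(M | J)` at a fixed value of `J`. -/
theorem sum_negMulLog_eq_add {ι : Type*} [Fintype ι] (r : ι → ℝ) (hr : ∀ i, 0 ≤ r i) (c : ℝ)
    (hc : ∑ i, r i = c) :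
    ∑ i, Real.negMulLog (r i) = Real.negMulLog c + c * ∑ i, Real.negMulLog (r i / c) := by
  by_cases h : c = 0
  · have h0 : ∀ i, r i = 0 := fun i =>
      (Finset.sum_eq_zero_iff_of_nonneg fun i _ => hr i).1 (hc.trans h) i (Finset.mem_univ i)
    simp [h, h0]
  · have h1 : ∀ i, Real.negMulLog (r i) =
        r i / c * Real.negMulLog c + c * Real.negMulLog (r i / c) := fun i => by
      rw [← Real.negMulLog_mul, mul_div_cancel₀ _ h]
    simp_rw [h1]
    rw [Finset.sum_add_distrib, ← Finset.sum_mul, ← Finset.mul_sum, ← Finset.sum_div, hc,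
      div_self h, one_mul]

theorem le_sum_fiber_sum_fiber {I J α β : Type*} [Fintype I] [Fintype J] [DecidableEq α]
    [DecidableEq β] {p : I → J → ℝ} (hp : ∀ a b, 0 ≤ p a b) {f : I → α} {g : J → β} (a : I) (b : J)
    {j : α} {m : β} (ha : f a = j) (hb : g b = m) :
    p a b ≤ ∑ a' with f a' = j, ∑ b' with g b' = m, p a' b' := by
  have h1 : p a b ≤ ∑ b' with g b' = m, p a b' :=
    Finset.single_le_sum (f := p a) (fun b' _ => hp a b')
      (Finset.mem_filter.2 ⟨Finset.mem_univ b, hb⟩)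
  refine h1.trans ?_
  exact Finset.single_le_sum (f := fun a' => ∑ b' with g b' = m, p a' b')
    (fun a' _ => Finset.sum_nonneg fun b' _ => hp a' b')
    (Finset.mem_filter.2 ⟨Finset.mem_univ a, ha⟩)

theorem sum_sum_mul_apply {I J α β : Type*} [Fintype I] [Fintype J] [Fintype α] [Fintype β]
    [DecidableEq α] [DecidableEq β] (p : I → J → ℝ) (f : I → α) (g : J → β) (φ : α → β → ℝ) :
    ∑ a, ∑ b, p a b * φ (f a) (g b) =
      ∑ j, ∑ m, (∑ a with f a = j, ∑ b with g b = m, p a b) * φ j m := by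
  rw [← Finset.sum_fiberwise Finset.univ f]
  refine Finset.sum_congr rfl fun j _ => ?_
  simp_rw [Finset.sum_mul]
  rw [Finset.sum_comm (s := Finset.univ)]
  refine Finset.sum_congr rfl fun a ha => ?_
  rw [← Finset.sum_fiberwise Finset.univ g]
  refine Finset.sum_congr rfl fun m _ => Finset.sum_congr rfl fun b hb => ?_
  rw [(Finset.mem_filter.1 ha).2, (Finset.mem_filter.1 hb).2]

section Joint

variable {κ : Type*} [Fintype κ] [DecidableEq κ] {α β : κ → Type*} [∀ l, Fintype (α l)]
  [∀ l, DecidableEq (α l)] [∀ l, Fintype (β l)] [∀ l, DecidableEq (β l)]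

/-- For random variables `A = (A_l)` and `B = (B_l)` with joint law `p`,
`H(A, B) ≤ H(B) + ∑ l, H(A_l | B_l)`. This is Gibbs' inequality for `p` against the law under which
the `A_l` are conditionally independent given `B`, each depending on `B_l` only. -/
theorem joint_entropy_le (p : (∀ l, α l) → (∀ l, β l) → ℝ) (hp : ∀ a b, 0 ≤ p a b) :
    ∑ a, ∑ b, Real.negMulLog (p a b) ≤ ∑ b, Real.negMulLog (∑ a, p a b)
      + ∑ l, (∑ j, ∑ m, Real.negMulLog (∑ a with a l = j, ∑ b with b l = m, p a b)
        - ∑ m, Real.negMulLog (∑ a, ∑ b with b l = m, p a b)) := by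
  obtain ⟨R, hR⟩ : ∃ R : (l : κ) → α l → β l → ℝ,
      ∀ l j m, R l j m = ∑ a with a l = j, ∑ b with b l = m, p a b := ⟨_, fun _ _ _ => rfl⟩
  obtain ⟨Q, hQ⟩ : ∃ Q : (l : κ) → β l → ℝ,
      ∀ l m, Q l m = ∑ a, ∑ b with b l = m, p a b := ⟨_, fun _ _ => rfl⟩
  obtain ⟨S, hS⟩ : ∃ S : (∀ l, β l) → ℝ, ∀ b, S b = ∑ a, p a b := ⟨_, fun _ => rfl⟩
  simp only [← hR, ← hQ, ← hS]
  have hR0 : ∀ l j m, 0 ≤ R l j m := fun l j m => by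
    rw [hR]
    exact Finset.sum_nonneg fun a _ => Finset.sum_nonneg fun b _ => hp a b
  have hQ0 : ∀ l m, 0 ≤ Q l m := fun l m => by
    rw [hQ]
    exact Finset.sum_nonneg fun a _ => Finset.sum_nonneg fun b _ => hp a b
  have hS0 : ∀ b, 0 ≤ S b := fun b => by
    rw [hS]
    exact Finset.sum_nonneg fun a _ => hp a b
  have hRQ : ∀ l m, ∑ j, R l j m = Q l m := fun l m => by
    simp only [hR, hQ]
    rw [Finset.sum_fiberwise]
  have hpR : ∀ a b l, p a b ≤ R l (a l) (b l) := fun a b l => by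
    rw [hR]
    exact le_sum_fiber_sum_fiber (f := fun a : ∀ l, α l => a l) (g := fun b : ∀ l, β l => b l)
      hp a b rfl rfl
  have hpS : ∀ a b, p a b ≤ S b := fun a b => by
    rw [hS]
    exact Finset.single_le_sum (f := fun a => p a b) (fun a _ => hp a b) (Finset.mem_univ a)
  have hRQ' : ∀ l j m, R l j m ≤ Q l m := fun l j m => by
    rw [← hRQ]
    exact Finset.single_le_sum (f := fun j => R l j m) (fun j _ => hR0 l j m) (Finset.mem_univ j)
  -- Gibbs' inequality, term by term
  have key : ∀ a b, Real.negMulLog (p a b) + p a b * (Real.log (S b)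
      + ∑ l, (Real.log (R l (a l) (b l)) - Real.log (Q l (b l)))) ≤
      S b * ∏ l, (R l (a l) (b l) / Q l (b l)) - p a b := by
    intro a b
    rcases (hp a b).eq_or_lt with h | h
    · rw [← h]
      simp only [Real.negMulLog_zero, zero_mul, add_zero, sub_zero]
      exact mul_nonneg (hS0 b) (Finset.prod_nonneg fun l _ => div_nonneg (hR0 _ _ _) (hQ0 _ _))
    · have hr : ∀ l, 0 < R l (a l) (b l) := fun l => h.trans_le (hpR a b l)
      have hq : ∀ l, 0 < Q l (b l) := fun l => (hr l).trans_le (hRQ' _ _ _)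
      have hs : 0 < S b := h.trans_le (hpS a b)
      have hpos : 0 < ∏ l, (R l (a l) (b l) / Q l (b l)) :=
        Finset.prod_pos fun l _ => div_pos (hr l) (hq l)
      have hlog : Real.log (S b) + ∑ l, (Real.log (R l (a l) (b l)) - Real.log (Q l (b l))) =
          Real.log (S b * ∏ l, (R l (a l) (b l) / Q l (b l))) := by
        rw [Real.log_mul hs.ne' hpos.ne', Real.log_prod fun l _ => (div_pos (hr l) (hq l)).ne']
        congr 1
        exact Finset.sum_congr rfl fun l _ => (Real.log_div (hr l).ne' (hq l).ne').symm
      rw [hlog]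
      set t := S b * ∏ l, (R l (a l) (b l) / Q l (b l)) with ht
      have ht0 : 0 < t := mul_pos hs hpos
      have h1 := Real.log_le_sub_one_of_pos (div_pos ht0 h)
      rw [Real.log_div ht0.ne' h.ne'] at h1
      have h2 := mul_le_mul_of_nonneg_left h1 h.le
      rw [mul_sub, mul_sub, mul_div_cancel₀ _ h.ne'] at h2
      rw [Real.negMulLog]
      linarith
  have hsum := Finset.sum_le_sum fun b (_ : b ∈ Finset.univ) =>
    Finset.sum_le_sum fun a (_ : a ∈ Finset.univ) => key a b
  -- the comparison law has at most the mass of `p`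
  have hmass : ∑ b, ∑ a : ∀ l, α l, (S b * ∏ l, (R l (a l) (b l) / Q l (b l)) - p a b) ≤ 0 := by
    refine Finset.sum_nonpos fun b _ => ?_
    rw [Finset.sum_sub_distrib, ← Finset.mul_sum, sub_nonpos, ← hS]
    refine mul_le_of_le_one_right (hS0 b) ?_
    have h1 := Finset.prod_univ_sum (fun l => (Finset.univ : Finset (α l)))
      fun l j => R l j (b l) / Q l (b l)
    rw [Fintype.piFinset_univ] at h1
    rw [← h1]
    refine Finset.prod_le_one (fun l _ => Finset.sum_nonneg fun j _ =>
      div_nonneg (hR0 _ _ _) (hQ0 _ _)) fun l _ => ?_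
    rw [← Finset.sum_div, hRQ]
    exact div_self_le_one _
  have hexp : ∑ b, ∑ a, (Real.negMulLog (p a b) + p a b * (Real.log (S b)
      + ∑ l, (Real.log (R l (a l) (b l)) - Real.log (Q l (b l))))) =
      ∑ b, ∑ a, Real.negMulLog (p a b) - ∑ b, Real.negMulLog (S b)
      + ∑ l, (∑ m, Real.negMulLog (Q l m) - ∑ j, ∑ m, Real.negMulLog (R l j m)) := by
    have e1 : ∑ b, ∑ a, p a b * Real.log (S b) = - ∑ b, Real.negMulLog (S b) := by
      simp_rw [← Finset.sum_mul, Real.negMulLog, neg_mul, Finset.sum_neg_distrib, neg_neg,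
        hS]
    have e2 : ∀ l, ∑ b, ∑ a, p a b * Real.log (R l (a l) (b l)) =
        - ∑ j, ∑ m, Real.negMulLog (R l j m) := fun l => by
      rw [Finset.sum_comm, sum_sum_mul_apply p (fun a => a l) (fun b => b l)
        fun j m => Real.log (R l j m)]
      simp only [← hR, Real.negMulLog, neg_mul, Finset.sum_neg_distrib, neg_neg]
    have e3 : ∀ l, ∑ b, ∑ a, p a b * Real.log (Q l (b l)) =
        - ∑ m, Real.negMulLog (Q l m) := fun l => by
      rw [Finset.sum_comm, sum_sum_mul_apply p (fun a => a l) (fun b => b l)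
        fun _ m => Real.log (Q l m), Finset.sum_comm]
      simp only [← hR, ← Finset.sum_mul, hRQ, Real.negMulLog, neg_mul, Finset.sum_neg_distrib,
        neg_neg]
    have e4 : ∑ b, ∑ a, p a b * ∑ l, (Real.log (R l (a l) (b l)) - Real.log (Q l (b l))) =
        ∑ l, (∑ m, Real.negMulLog (Q l m) - ∑ j, ∑ m, Real.negMulLog (R l j m)) := by
      simp_rw [Finset.mul_sum]
      rw [Finset.sum_congr rfl fun b _ => Finset.sum_comm, Finset.sum_comm]
      refine Finset.sum_congr rfl fun l _ => ?_
      simp_rw [mul_sub, Finset.sum_sub_distrib]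
      rw [e2, e3]
      ring
    simp_rw [mul_add, Finset.sum_add_distrib]
    rw [e1, e4]
    ring
  rw [hexp] at hsum
  rw [Finset.sum_comm]
  simp only [Finset.sum_sub_distrib] at hsum hmass ⊢
  linarith

/-- `H(A) ≤ H(B) + ∑ l, H(A_l | B_l)`. -/
theorem entropy_le (p : (∀ l, α l) → (∀ l, β l) → ℝ) (hp : ∀ a b, 0 ≤ p a b) :
    ∑ a, Real.negMulLog (∑ b, p a b) ≤ ∑ b, Real.negMulLog (∑ a, p a b)
      + ∑ l, (∑ j, ∑ m, Real.negMulLog (∑ a with a l = j, ∑ b with b l = m, p a b)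
        - ∑ m, Real.negMulLog (∑ a, ∑ b with b l = m, p a b)) :=
  (Finset.sum_le_sum fun a _ => negMulLog_sum_le _ _ fun b _ => hp a b).trans
    (joint_entropy_le p hp)

end Joint

/-! ### The entropy of a functional on an abelian algebra -/

section AbelianEntropy

variable {A : Type*} [Ring A] [StarRing A] [Algebra ℂ A]

/-- On an abelian algebra with minimal projections `e m` (some of which may vanish) the members of
any spectral resolution are exactly the nonzero `e m`, so that the von Neumann entropy is the
Shannon entropy of the weights of the `e m`. -/
theorem vonNeumannEntropy_eq_sum (hcomm : ∀ x y : A, x * y = y * x) {q : ℕ} {e : Fin q → A}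
    (he : ∀ m, IsStarProjection (e m)) (horth : ∀ m n, m ≠ n → e m * e n = 0)
    (hsum : ∑ m, e m = 1) (hmin : ∀ m x, ∃ c : ℂ, e m * x = c • e m) (φ : A →ₗ[ℂ] ℂ) :
    vonNeumannEntropy φ = ∑ m, Real.negMulLog (φ (e m)).re := by
  have hidem : ∀ m, e m * e m = e m := fun m => (he m).isIdempotentElem
  have hres : ∀ (d : ℕ) (p : Fin d → A), IsSpectralResolution φ p →
      ∑ i, Real.negMulLog (φ (p i)).re = ∑ m, Real.negMulLog (φ (e m)).re := by
    intro d p hp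
    have hpi : ∀ i, p i * p i = p i := fun i => (hp.proj i).isIdempotentElem
    have heq : ∀ i m, e m * p i ≠ 0 → p i = e m := by
      intro i m hne
      obtain ⟨c, hc⟩ := hmin m (p i)
      obtain ⟨c', hc'⟩ := hp.minimal i (e m)
      rw [hcomm (p i), mul_assoc, hpi] at hc'
      have h1 : (c - 1) • (e m * p i) = 0 := by
        rw [sub_smul, one_smul, ← smul_mul_assoc, ← hc, mul_assoc, hpi, sub_self]
      have h2 : (c' - 1) • (e m * p i) = 0 := by
        rw [sub_smul, one_smul, ← mul_smul_comm, ← hc', ← mul_assoc, hidem, sub_self]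
      rw [sub_eq_zero.1 ((smul_eq_zero.1 h1).resolve_right hne), one_smul] at hc
      rw [sub_eq_zero.1 ((smul_eq_zero.1 h2).resolve_right hne), one_smul] at hc'
      rw [← hc', hc]
    have hex : ∀ i, ∃ m, p i = e m := by
      intro i
      by_contra! hcon
      refine hp.ne_zero i ?_
      rw [← one_mul (p i), ← hsum, Finset.sum_mul]
      exact Finset.sum_eq_zero fun m _ => by_contra fun h => hcon m (heq i m h)
    choose f hf using hex
    refine Finset.sum_of_injOn f ?_ (fun _ _ => Finset.mem_coe.2 (Finset.mem_univ _)) ?_ ?_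
    · intro i _ j _ hij
      by_contra hne
      refine hp.ne_zero i ?_
      have h := hp.orthogonal i j hne
      rwa [hf j, ← hij, ← hf i, hpi] at h
    · intro m _ hm
      have h0 : e m = 0 := by
        rw [← mul_one (e m), ← hp.sum_eq_one, Finset.mul_sum]
        refine Finset.sum_eq_zero fun i _ => by_contra fun h => hm ⟨i, by simp, ?_⟩
        by_contra hne
        rw [hf i] at h
        exact h (horth _ _ (Ne.symm hne))
      simp [h0]
    · intro i _
      rw [hf i]
  have hex : ∃ (d : ℕ) (p : Fin d → A), IsSpectralResolution φ p := by
    classical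
    let g := (Fintype.equivFin {m // e m ≠ 0}).symm
    have hg : ∑ i, e (g i) = 1 := by
      rw [← hsum]
      refine Finset.sum_of_injOn (fun i => (g i : Fin q)) ?_
        (fun _ _ => Finset.mem_coe.2 (Finset.mem_univ _)) ?_ fun _ _ => rfl
      · exact (Subtype.val_injective.comp g.injective).injOn
      · intro m _ hm
        by_contra h
        exact hm ⟨g.symm ⟨m, h⟩, by simp, by simp⟩
    refine ⟨_, fun i => e (g i), fun i => he _, fun i => (g i).2, fun i x => ?_, fun i j hij => ?_,
      hg, fun x => ?_⟩
    · obtain ⟨c, hc⟩ := hmin (g i) x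
      exact ⟨c, by rw [hc, smul_mul_assoc, hidem]⟩
    · exact horth _ _ fun h => hij (g.injective (Subtype.ext h))
    · rw [← map_sum]
      congr 1
      simp_rw [hcomm _ (e _), ← mul_assoc, hidem]
      rw [← Finset.sum_mul, hg, one_mul]
  obtain ⟨d, p, hp⟩ := hex
  have hset : {s : ℝ | ∃ (d : ℕ) (p : Fin d → A), IsSpectralResolution φ p ∧
      s = ∑ i, Real.negMulLog (φ (p i)).re} = {∑ m, Real.negMulLog (φ (e m)).re} := by
    ext s
    constructor
    · rintro ⟨d, p, hp, rfl⟩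
      exact hres d p hp
    · rintro rfl
      exact ⟨d, p, hp, (hres d p hp).symm⟩
  rw [vonNeumannEntropy, hset, csInf_singleton]

end AbelianEntropy

section PartitionAlgebra

variable {X : Type*} [MeasurableSpace X] {μ : Measure X} [IsFiniteMeasure μ]

theorem coeFn_charFn {s : Set X} (hs : MeasurableSet s) :
    ⇑(charFn (μ := μ) hs) =ᵐ[μ] s.indicator fun _ => (1 : ℂ) :=
  indicatorConstLp_coeFn

theorem charFn_mul_charFn {s t : Set X} (hs : MeasurableSet s) (ht : MeasurableSet t) :
    charFn (μ := μ) hs * charFn ht = charFn (hs.inter ht) := by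
  refine Lp.ext ?_
  filter_upwards [coeFn_mul (charFn (μ := μ) hs) (charFn ht), coeFn_charFn (μ := μ) hs,
    coeFn_charFn (μ := μ) ht, coeFn_charFn (μ := μ) (hs.inter ht)] with x h1 h2 h3 h4
  rw [h1, h2, h3, h4]
  by_cases hxs : x ∈ s <;> by_cases hxt : x ∈ t <;> simp [hxs, hxt]

theorem star_charFn {s : Set X} (hs : MeasurableSet s) :
    star (charFn (μ := μ) hs) = charFn hs := by
  refine Lp.ext ?_
  filter_upwards [coeFn_starLp (charFn (μ := μ) hs), coeFn_charFn (μ := μ) hs] with x h1 h2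
  rw [h1, h2]
  by_cases h : x ∈ s <;> simp [h]

variable {q : ℕ} {P : Fin q → Set X} (hP : IsMeasurablePartition P)

theorem charFn_mul_charFn_of_ne {m n : Fin q} (h : m ≠ n) :
    charFn (μ := μ) (hP.measurableSet m) * charFn (hP.measurableSet n) = 0 := by
  refine Lp.ext ?_
  filter_upwards [coeFn_mul (charFn (μ := μ) (hP.measurableSet m)) (charFn (hP.measurableSet n)),
    coeFn_charFn (μ := μ) (hP.measurableSet m), coeFn_charFn (μ := μ) (hP.measurableSet n),
    Lp.coeFn_zero ℂ ∞ μ] with x h1 h2 h3 h4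
  rw [h1, h2, h3, h4]
  by_cases hm : x ∈ P m
  · simp [Set.disjoint_left.1 (hP.disjoint m n h) hm]
  · simp [hm]

theorem charFn_mul_self (m : Fin q) :
    charFn (μ := μ) (hP.measurableSet m) * charFn (hP.measurableSet m) =
      charFn (hP.measurableSet m) := by
  rw [charFn_mul_charFn]
  simp only [Set.inter_self]

theorem sum_charFn : ∑ m, charFn (μ := μ) (hP.measurableSet m) = 1 := by
  refine Lp.ext ?_
  have h : ∀ᵐ x ∂μ, ∀ m, charFn (μ := μ) (hP.measurableSet m) x =
      (P m).indicator (fun _ => (1 : ℂ)) x := by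
    rw [ae_all_iff]
    exact fun m => coeFn_charFn (hP.measurableSet m)
  filter_upwards [h, Lp.coeFn_finsetSum (Finset.univ) fun m =>
    charFn (μ := μ) (hP.measurableSet m), coeFn_one (μ := μ)] with x h1 h2 h3
  rw [h2, h3, Finset.sum_apply]
  simp_rw [h1]
  obtain ⟨m, hm⟩ := Set.mem_iUnion.1 (hP.iUnion_eq.symm ▸ Set.mem_univ x : x ∈ ⋃ i, P i)
  rw [Finset.sum_eq_single m]
  · simp [hm]
  · intro n _ hn
    simp [Set.disjoint_left.1 (hP.disjoint m n hn.symm) hm]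
  · simp

variable (μ) in
/-- The characteristic function of an atom, as an element of the algebra of the partition. -/
noncomputable def atomFn (m : Fin q) : partitionAlgebra μ hP :=
  ⟨charFn (hP.measurableSet m), StarAlgebra.subset_adjoin ℂ _ ⟨m, rfl⟩⟩

theorem exists_charFn_mul_eq_smul (m : Fin q) (x : Lp ℂ ∞ μ) (hx : x ∈ partitionAlgebra μ hP) :
    ∃ c : ℂ, charFn (hP.measurableSet m) * x = c • charFn (hP.measurableSet m) := by
  refine StarAlgebra.adjoin_induction (p := fun x _ => ∃ c : ℂ,
    charFn (hP.measurableSet m) * x = c • charFn (hP.measurableSet m)) ?_ ?_ ?_ ?_ ?_ hx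
  · rintro _ ⟨n, rfl⟩
    by_cases h : m = n
    · subst h
      exact ⟨1, by rw [charFn_mul_self hP, one_smul]⟩
    · exact ⟨0, by rw [zero_smul]; exact charFn_mul_charFn_of_ne hP h⟩
  · intro r
    exact ⟨r, by rw [Algebra.algebraMap_eq_smul_one, mul_smul_comm, mul_one]⟩
  · rintro x y _ _ ⟨c, hc⟩ ⟨d, hd⟩
    exact ⟨c + d, by rw [mul_add, hc, hd, add_smul]⟩
  · rintro x y _ _ ⟨c, hc⟩ ⟨d, hd⟩
    exact ⟨c * d, by rw [← mul_assoc, hc, smul_mul_assoc, hd, smul_smul]⟩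
  · rintro x _ ⟨c, hc⟩
    refine ⟨star c, ?_⟩
    rw [mul_comm, ← star_charFn (hP.measurableSet m), ← star_smul, ← star_mul, hc]

theorem vonNeumannEntropy_partitionAlgebra (φ : partitionAlgebra μ hP →ₗ[ℂ] ℂ) :
    vonNeumannEntropy φ = ∑ m, Real.negMulLog (φ (atomFn μ hP m)).re := by
  refine vonNeumannEntropy_eq_sum (fun x y => Subtype.ext (mul_comm _ _)) (fun m => ⟨?_, ?_⟩)
    (fun m n h => Subtype.ext (charFn_mul_charFn_of_ne hP h)) ?_ (fun m x => ?_) φ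
  · exact Subtype.ext (charFn_mul_self hP m)
  · exact Subtype.ext (star_charFn (hP.measurableSet m))
  · refine Subtype.ext ?_
    rw [AddSubmonoidClass.coe_finsetSum]
    exact sum_charFn hP
  · obtain ⟨c, hc⟩ := exists_charFn_mul_eq_smul hP m (x : Lp ℂ ∞ μ) x.2
    exact ⟨c, Subtype.ext hc⟩

end PartitionAlgebra

/-! ### Bounds for the subalgebra functional -/

section States

variable {M : Type*} [Ring M] [StarRing M] [Algebra ℂ M]

/-- A positive-operator-valued measure with finitely many outcomes: positive elements with sum
one. -/
structure IsPOVM {ι : Type*} [Fintype ι] (E : ι → M) : Prop where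
  pos : ∀ i, ∃ x, E i = star x * x
  sum_eq_one : ∑ i, E i = 1

variable {ω : M →ₗ[ℂ] ℂ}

theorem IsState.re_nonneg (hω : IsState ω) {ι : Type*} [Fintype ι] {E : ι → M} (hE : IsPOVM E)
    (i : ι) : 0 ≤ (ω (E i)).re := by
  obtain ⟨x, hx⟩ := hE.pos i
  rw [hx]
  exact (Complex.le_def.1 (hω.nonneg x)).1

theorem IsState.sum_re (hω : IsState ω) {ι : Type*} [Fintype ι] {E : ι → M} (hE : IsPOVM E) :
    ∑ i, (ω (E i)).re = 1 := by
  rw [← Complex.re_sum, ← map_sum, hE.sum_eq_one, hω.map_one, Complex.one_re]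

theorem IsState.re_mem_Icc (hω : IsState ω) {ι : Type*} [Fintype ι] {E : ι → M} (hE : IsPOVM E)
    (i : ι) : (ω (E i)).re ∈ Set.Icc (0 : ℝ) 1 :=
  ⟨hω.re_nonneg hE i, (Finset.single_le_sum (f := fun i => (ω (E i)).re)
    (fun i _ => hω.re_nonneg hE i) (Finset.mem_univ i)).trans_eq (hω.sum_re hE)⟩

/-- The variance of a self-adjoint element is nonnegative. -/
theorem IsState.sq_re_le [StarModule ℂ M] (hω : IsState ω) {x : M} (hx : star x = x) :
    (ω x).re ^ 2 ≤ (ω (x * x)).re := by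
  have h := (Complex.le_def.1 (hω.nonneg (x - ((ω x).re : ℂ) • 1))).1
  have h1 : star (x - ((ω x).re : ℂ) • (1 : M)) = x - ((ω x).re : ℂ) • 1 := by
    rw [star_sub, star_smul, star_one, hx, Complex.star_def, Complex.conj_ofReal]
  rw [h1] at h
  simp only [sub_mul, mul_sub, smul_mul_assoc, mul_smul_comm, one_mul, mul_one, map_sub, map_smul,
    hω.map_one, smul_eq_mul, Complex.sub_re, Complex.re_ofReal_mul, Complex.ofReal_re,
    Complex.zero_re] at h
  nlinarith

namespace StateDecomposition

variable {k : ℕ} (D : StateDecomposition ω k)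

theorem subWeight_nonneg (l : Fin k) (j : Fin (D.card l)) : 0 ≤ D.subWeight l j :=
  Finset.sum_nonneg fun i _ => D.weight_nonneg i

theorem sum_subWeight (l : Fin k) : ∑ j, D.subWeight l j = 1 := by
  rw [← D.sum_weight]
  simp only [subWeight]
  rw [Finset.sum_fiberwise]

theorem subState_re (l : Fin k) (j : Fin (D.card l)) (x : M) :
    (D.subState l j x).re = (∑ i with i l = j, D.weight i * (D.state i x).re) / D.subWeight l j := by
  rw [subState, LinearMap.sum_apply, Complex.re_sum, Finset.sum_div]
  refine Finset.sum_congr rfl fun i _ => ?_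
  rw [LinearMap.smul_apply, smul_eq_mul, Complex.re_ofReal_mul, div_mul_eq_mul_div]

theorem subWeight_mul_subState_re (l : Fin k) (j : Fin (D.card l)) (x : M) :
    D.subWeight l j * (D.subState l j x).re =
      ∑ i with i l = j, D.weight i * (D.state i x).re := by
  rw [subState_re]
  by_cases h : D.subWeight l j = 0
  · rw [h, zero_mul]
    refine (Finset.sum_eq_zero fun i hi => ?_).symm
    rw [(Finset.sum_eq_zero_iff_of_nonneg fun i _ => D.weight_nonneg i).1 h i hi, zero_mul]
  · rw [mul_div_cancel₀ _ h]

theorem re_apply (x : M) : (ω x).re = ∑ i, D.weight i * (D.state i x).re := by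
  conv_lhs => rw [D.decomp]
  rw [LinearMap.sum_apply, Complex.re_sum]
  refine Finset.sum_congr rfl fun i _ => ?_
  rw [LinearMap.smul_apply, smul_eq_mul, Complex.re_ofReal_mul]

theorem sum_subWeight_mul_subState_re (l : Fin k) (x : M) :
    ∑ j, D.subWeight l j * (D.subState l j x).re = (ω x).re := by
  simp_rw [subWeight_mul_subState_re]
  rw [Finset.sum_fiberwise, D.re_apply]

theorem isState_subState {l : Fin k} {j : Fin (D.card l)} (h : D.subWeight l j ≠ 0) :
    IsState (D.subState l j) where
  nonneg x := by
    rw [subState, LinearMap.sum_apply]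
    refine Finset.sum_nonneg fun i _ => ?_
    rw [LinearMap.smul_apply, smul_eq_mul]
    exact mul_nonneg (Complex.zero_le_real.2
      (div_nonneg (D.weight_nonneg i) (D.subWeight_nonneg l j))) ((D.isState i).nonneg x)
  map_one := by
    rw [subState, LinearMap.sum_apply]
    simp_rw [LinearMap.smul_apply, (D.isState _).map_one, smul_eq_mul, mul_one]
    rw [← Complex.ofReal_sum, ← Finset.sum_div, ← subWeight, div_self h, Complex.ofReal_one]

variable {A : Type*} [Ring A] [StarRing A] [Algebra ℂ A] {q : ℕ} {e : Fin q → A}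

theorem value_eq (he : ∀ φ : A →ₗ[ℂ] ℂ,
      vonNeumannEntropy φ = ∑ m, Real.negMulLog (φ (e m)).re) (γ : Fin k → A →ₗ[ℂ] M) :
    D.value γ = ∑ i, Real.negMulLog (D.weight i) - ∑ l, ∑ j, Real.negMulLog (D.subWeight l j)
      + ∑ l, (∑ m, Real.negMulLog (ω (γ l (e m))).re
        - ∑ j, D.subWeight l j * ∑ m, Real.negMulLog (D.subState l j (γ l (e m))).re) := by
  simp only [value, he, LinearMap.comp_apply]

/-- The value of a decomposition is at most the Shannon entropy of the outcome distribution of a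
POVM `Y` whose marginals are close, in the seminorm `ω(x²)`, to the images of the `e m` under the
maps `γ l`. With equality of the marginals this is `H(A) - ∑ l, H(A_l | B_l) ≤ H(B)` for the index
`A` of the decomposition and the outcome `B` of `Y`. -/
theorem value_le [StarModule ℂ M] (he : ∀ φ : A →ₗ[ℂ] ℂ,
      vonNeumannEntropy φ = ∑ m, Real.negMulLog (φ (e m)).re) (γ : Fin k → A →ₗ[ℂ] M)
    {Y : (Fin k → Fin q) → M} (hY : IsPOVM Y) {F : Fin k → Fin q → M}
    (hF : ∀ l, IsPOVM (F l)) (hYF : ∀ l m, ∑ b with b l = m, Y b = F l m)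
    (hG : ∀ l, IsPOVM fun m => γ l (e m))
    (hsa : ∀ l m, star (γ l (e m) - F l m) = γ l (e m) - F l m)
    (hω : ∀ l m, (ω (γ l (e m))).re = (ω (F l m)).re) {ε K δ : ℝ} (hK : 0 ≤ K)
    (hmod : ∀ s ∈ Set.Icc (0 : ℝ) 1, ∀ t ∈ Set.Icc (0 : ℝ) 1,
      |Real.negMulLog s - Real.negMulLog t| ≤ ε + K * (s - t) ^ 2)
    (hδ : ∀ l m, (ω ((γ l (e m) - F l m) * (γ l (e m) - F l m))).re ≤ δ) :
    D.value γ ≤ ∑ b, Real.negMulLog (ω (Y b)).re + k * (q * (ε + K * δ)) := by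
  have hent := entropy_le (fun i b => D.weight i * (D.state i (Y b)).re) fun i b =>
    mul_nonneg (D.weight_nonneg i) ((D.isState i).re_nonneg hY b)
  have hre : ∀ i l m, ∑ b with b l = m, D.weight i * (D.state i (Y b)).re =
      D.weight i * (D.state i (F l m)).re := fun i l m => by
    rw [← hYF, map_sum, Complex.re_sum, Finset.mul_sum]
  simp_rw [hre, ← D.re_apply, ← subWeight_mul_subState_re, ← Finset.mul_sum,
    (D.isState _).sum_re hY, mul_one] at hent
  have hchain : ∀ l j, ∑ m, Real.negMulLog (D.subWeight l j * (D.subState l j (F l m)).re) =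
      Real.negMulLog (D.subWeight l j)
        + D.subWeight l j * ∑ m, Real.negMulLog (D.subState l j (F l m)).re := by
    intro l j
    by_cases h : D.subWeight l j = 0
    · simp [h]
    · rw [sum_negMulLog_eq_add _ (fun m => mul_nonneg (D.subWeight_nonneg l j)
        ((D.isState_subState h).re_nonneg (hF l) m)) (D.subWeight l j)
        (by rw [← Finset.mul_sum, (D.isState_subState h).sum_re (hF l), mul_one])]
      simp_rw [mul_div_cancel_left₀ _ h]
  have hdiff : ∀ l, ∑ j, D.subWeight l j * ∑ m, Real.negMulLog (D.subState l j (F l m)).re ≤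
      ∑ j, D.subWeight l j * ∑ m, Real.negMulLog (D.subState l j (γ l (e m))).re
        + q * (ε + K * δ) := by
    intro l
    have h1 : ∀ j m, D.subWeight l j * Real.negMulLog (D.subState l j (F l m)).re ≤
        D.subWeight l j * Real.negMulLog (D.subState l j (γ l (e m))).re
          + (D.subWeight l j * ε + K * (D.subWeight l j *
            (D.subState l j ((γ l (e m) - F l m) * (γ l (e m) - F l m))).re)) := by
      intro j m
      by_cases h : D.subWeight l j = 0
      · simp [h]
      · have hst := D.isState_subState h
        have h2 := (abs_le.1 (hmod _ (hst.re_mem_Icc (hG l) m) _ (hst.re_mem_Icc (hF l) m))).1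
        have h3 := mul_le_mul_of_nonneg_left (hst.sq_re_le (hsa l m)) hK
        rw [map_sub, Complex.sub_re] at h3
        have h4 : Real.negMulLog (D.subState l j (F l m)).re ≤
            Real.negMulLog (D.subState l j (γ l (e m))).re + (ε + K *
            (D.subState l j ((γ l (e m) - F l m) * (γ l (e m) - F l m))).re) := by linarith
        have h5 := mul_le_mul_of_nonneg_left h4 (D.subWeight_nonneg l j)
        linarith
    calc ∑ j, D.subWeight l j * ∑ m, Real.negMulLog (D.subState l j (F l m)).re
        = ∑ j, ∑ m, D.subWeight l j * Real.negMulLog (D.subState l j (F l m)).re :=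
          Finset.sum_congr rfl fun j _ => Finset.mul_sum _ _ _
      _ ≤ ∑ j, ∑ m, (D.subWeight l j * Real.negMulLog (D.subState l j (γ l (e m))).re
          + (D.subWeight l j * ε + K * (D.subWeight l j *
            (D.subState l j ((γ l (e m) - F l m) * (γ l (e m) - F l m))).re))) :=
          Finset.sum_le_sum fun j _ => Finset.sum_le_sum fun m _ => h1 j m
      _ = ∑ j, D.subWeight l j * ∑ m, Real.negMulLog (D.subState l j (γ l (e m))).re
          + ∑ m, (ε + K * (ω ((γ l (e m) - F l m) * (γ l (e m) - F l m))).re) := by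
          simp only [Finset.sum_add_distrib]
          congr 1
          · exact Finset.sum_congr rfl fun j _ => (Finset.mul_sum _ _ _).symm
          congr 1
          · rw [Finset.sum_comm]
            simp [← Finset.sum_mul, D.sum_subWeight]
          · rw [Finset.sum_comm]
            simp_rw [← Finset.mul_sum, D.sum_subWeight_mul_subState_re]
      _ ≤ _ := by
          gcongr
          have h6 := Finset.sum_le_sum fun m (_ : m ∈ (Finset.univ : Finset (Fin q))) =>
            add_le_add_right (mul_le_mul_of_nonneg_left (hδ l m) hK) ε
          refine h6.trans_eq ?_
          rw [Finset.sum_const, Finset.card_univ, Fintype.card_fin, nsmul_eq_mul]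
  rw [D.value_eq he]
  have hsum := Finset.sum_le_sum fun l (_ : l ∈ (Finset.univ : Finset (Fin k))) => hdiff l
  simp only [hchain, Finset.sum_add_distrib, Finset.sum_sub_distrib, Finset.sum_const,
    Finset.card_univ, Fintype.card_fin, nsmul_eq_mul, hω] at hent hsum ⊢
  linarith

/-- If in each coarse graining the index `j` of the decomposition almost determines the outcome
`f l j` of the POVM `m ↦ γ l (e m)`, then the value of the decomposition is almost the Shannon
entropy of its weights. -/
theorem le_value (he : ∀ φ : A →ₗ[ℂ] ℂ,
      vonNeumannEntropy φ = ∑ m, Real.negMulLog (φ (e m)).re) (γ : Fin k → A →ₗ[ℂ] M)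
    (hG : ∀ l, IsPOVM fun m => γ l (e m)) (f : ∀ l, Fin (D.card l) → Fin q)
    (hcard : ∀ l, D.card l ≤ q)
    (hmarg : ∀ l, ∑ j, Real.negMulLog (D.subWeight l j) =
      ∑ m, Real.negMulLog (ω (γ l (e m))).re)
    {ε K δ : ℝ} (hK : 0 ≤ K) (hδ0 : 0 ≤ δ)
    (hmod : ∀ s ∈ Set.Icc (0 : ℝ) 1, ∀ t ∈ Set.Icc (0 : ℝ) 1,
      |Real.negMulLog s - Real.negMulLog t| ≤ ε + K * (s - t) ^ 2)
    (hδ : ∀ l j, D.subWeight l j - δ ≤ D.subWeight l j * (D.subState l j (γ l (e (f l j)))).re) :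
    ∑ i, Real.negMulLog (D.weight i) - k * (q * (ε + q * (K * δ))) ≤ D.value γ := by
  have hbound : ∀ l j,
      D.subWeight l j * ∑ m, Real.negMulLog (D.subState l j (γ l (e m))).re ≤
        q * (D.subWeight l j * ε + K * δ) := by
    intro l j
    by_cases h : D.subWeight l j = 0
    · rw [h, zero_mul, zero_mul, zero_add]
      positivity
    · have hst := D.isState_subState h
      have hw0 := D.subWeight_nonneg l j
      rw [Finset.mul_sum]
      have hterm : ∀ m, D.subWeight l j * Real.negMulLog (D.subState l j (γ l (e m))).re ≤
          D.subWeight l j * ε + K * δ := by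
        intro m
        set a : Fin q → ℝ := fun m => (D.subState l j (γ l (e m))).re with ha
        have ha01 : ∀ m, a m ∈ Set.Icc (0 : ℝ) 1 := fun m => hst.re_mem_Icc (hG l) m
        have hδj : D.subWeight l j * (1 - a (f l j)) ≤ δ := by
          have := hδ l j
          rw [mul_sub, mul_one]
          linarith
        change D.subWeight l j * Real.negMulLog (a m) ≤ _
        -- `a m` is compared with its limiting value, `1` if `m = f l j` and `0` otherwise
        obtain ⟨t, ht, ht0, htd⟩ : ∃ t ∈ Set.Icc (0 : ℝ) 1, Real.negMulLog t = 0 ∧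
            (a m - t) ^ 2 ≤ 1 - a (f l j) := by
          by_cases hm : m = f l j
          · rw [← hm]
            exact ⟨1, by simp, by simp, by nlinarith [(ha01 m).1, (ha01 m).2]⟩
          · refine ⟨0, by simp, by simp, ?_⟩
            have h1 : a m + a (f l j) ≤ 1 := by
              have h2 : ∑ m, a m = 1 := hst.sum_re (hG l)
              rw [← h2, ← Finset.sum_pair hm]
              exact Finset.sum_le_sum_of_subset_of_nonneg (Finset.subset_univ _)
                fun i _ _ => (ha01 i).1
            nlinarith [(ha01 m).1, (ha01 m).2]
        have h2 := (le_abs_self _).trans (hmod _ (ha01 m) t ht)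
        rw [ht0, sub_zero] at h2
        have h3 := mul_le_mul_of_nonneg_left
          (h2.trans (add_le_add_right (mul_le_mul_of_nonneg_left htd hK) ε)) hw0
        have h4 := mul_le_mul_of_nonneg_left hδj hK
        linarith
      refine (Finset.sum_le_sum fun m _ => hterm m).trans_eq ?_
      rw [Finset.sum_const, Finset.card_univ, Fintype.card_fin, nsmul_eq_mul]
  have htot : ∀ l, ∑ j, D.subWeight l j * ∑ m, Real.negMulLog (D.subState l j (γ l (e m))).re ≤
        q * (ε + q * (K * δ)) := by
    intro l
    refine (Finset.sum_le_sum fun j _ => hbound l j).trans ?_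
    rw [← Finset.mul_sum, Finset.sum_add_distrib, ← Finset.sum_mul, D.sum_subWeight,
      Finset.sum_const, Finset.card_univ, Fintype.card_fin, nsmul_eq_mul, one_mul]
    have := hcard l
    gcongr
  rw [D.value_eq he]
  have hsum := Finset.sum_le_sum fun l (_ : l ∈ (Finset.univ : Finset (Fin k))) => htot l
  simp only [Finset.sum_sub_distrib, Finset.sum_const, Finset.card_univ, Fintype.card_fin,
    nsmul_eq_mul, hmarg] at hsum ⊢
  linarith

end StateDecomposition

/-- The decomposition of a state `ω` into positive functionals `ψ b`, normalized to states; where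
`ψ b` vanishes the state is irrelevant and taken to be `ω`. -/
noncomputable def decompositionOfFunctionals (hω : IsState ω) {k q : ℕ}
    (ψ : (Fin k → Fin q) → M →ₗ[ℂ] ℂ) (hpos : ∀ b x, 0 ≤ ψ b (star x * x))
    (hzero : ∀ b, ψ b 1 = 0 → ψ b = 0) (hsum : ∑ b, ψ b = ω) : StateDecomposition ω k :=
  have hre : ∀ b, 0 ≤ ψ b 1 := fun b => by simpa using hpos b 1
  have hofReal : ∀ b, (((ψ b 1).re : ℝ) : ℂ) = ψ b 1 := fun b =>
    (Complex.eq_re_of_ofReal_le (hre b)).symm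
  { card := fun _ => q
    weight := fun b => (ψ b 1).re
    state := fun b => if ψ b 1 = 0 then ω else (ψ b 1)⁻¹ • ψ b
    weight_nonneg := fun b => (Complex.le_def.1 (hre b)).1
    sum_weight := by
      rw [← Complex.re_sum, ← LinearMap.sum_apply, hsum, hω.map_one, Complex.one_re]
    isState := fun b => by
      split_ifs with h
      · exact hω
      · refine ⟨fun x => ?_, ?_⟩
        · rw [LinearMap.smul_apply, smul_eq_mul, ← hofReal, ← Complex.ofReal_inv]
          exact mul_nonneg (Complex.zero_le_real.2
            (inv_nonneg.2 (Complex.le_def.1 (hre b)).1)) (hpos b x)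
        · rw [LinearMap.smul_apply, smul_eq_mul, inv_mul_cancel₀ h]
    decomp := by
      rw [← hsum]
      refine Finset.sum_congr rfl fun b _ => ?_
      rw [hofReal]
      split_ifs with h
      · rw [h, zero_smul, hzero b h]
      · rw [smul_smul, mul_inv_cancel₀ h, one_smul] }

section

variable (hω : IsState ω) {k q : ℕ} (ψ : (Fin k → Fin q) → M →ₗ[ℂ] ℂ)
  (hpos : ∀ b x, 0 ≤ ψ b (star x * x)) (hzero : ∀ b, ψ b 1 = 0 → ψ b = 0) (hsum : ∑ b, ψ b = ω)

theorem decompositionOfFunctionals_subWeight (l : Fin k) (j : Fin q) :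
    (decompositionOfFunctionals hω ψ hpos hzero hsum).subWeight l j =
      (∑ b with b l = j, ψ b 1).re := by
  rw [Complex.re_sum]
  rfl

theorem decompositionOfFunctionals_subWeight_mul (l : Fin k) (j : Fin q) (x : M) :
    (decompositionOfFunctionals hω ψ hpos hzero hsum).subWeight l j *
      ((decompositionOfFunctionals hω ψ hpos hzero hsum).subState l j x).re =
      (∑ b with b l = j, ψ b x).re := by
  have hws : ∀ b : Fin k → Fin q,
      (ψ b 1).re * ((if ψ b 1 = 0 then ω else (ψ b 1)⁻¹ • ψ b) x).re = (ψ b x).re := fun b => by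
    have h1 : (((ψ b 1).re : ℝ) : ℂ) = ψ b 1 :=
      (Complex.eq_re_of_ofReal_le (r := 0) (by simpa using hpos b 1)).symm
    rw [← Complex.re_ofReal_mul, h1]
    split_ifs with h
    · rw [h, hzero b h, zero_mul, LinearMap.zero_apply]
    · rw [LinearMap.smul_apply, smul_eq_mul, mul_inv_cancel_left₀ h]
  refine ((decompositionOfFunctionals hω ψ hpos hzero hsum).subWeight_mul_subState_re l j x).trans ?_
  rw [Complex.re_sum]
  exact Finset.sum_congr rfl fun b _ => hws b

variable {A : Type*} [Ring A] [StarRing A] [Algebra ℂ A] {e : Fin q → A}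

theorem le_value_decompositionOfFunctionals (he : ∀ φ : A →ₗ[ℂ] ℂ,
      vonNeumannEntropy φ = ∑ m, Real.negMulLog (φ (e m)).re) (γ : Fin k → A →ₗ[ℂ] M)
    (hG : ∀ l, IsPOVM fun m => γ l (e m))
    (hmarg : ∀ l j, (∑ b with b l = j, ψ b 1).re = (ω (γ l (e j))).re)
    {ε K δ : ℝ} (hK : 0 ≤ K) (hδ0 : 0 ≤ δ)
    (hmod : ∀ s ∈ Set.Icc (0 : ℝ) 1, ∀ t ∈ Set.Icc (0 : ℝ) 1,
      |Real.negMulLog s - Real.negMulLog t| ≤ ε + K * (s - t) ^ 2)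
    (hδ : ∀ l j, (ω (γ l (e j))).re - δ ≤ (∑ b with b l = j, ψ b (γ l (e j))).re) :
    ∑ b, Real.negMulLog (ψ b 1).re - k * (q * (ε + q * (K * δ))) ≤
      (decompositionOfFunctionals hω ψ hpos hzero hsum).value γ := by
  have hw : ∀ l (j : Fin q), (decompositionOfFunctionals hω ψ hpos hzero hsum).subWeight l j =
      (ω (γ l (e j))).re := fun l j =>
    (decompositionOfFunctionals_subWeight hω ψ hpos hzero hsum l j).trans (hmarg l j)
  refine (decompositionOfFunctionals hω ψ hpos hzero hsum).le_value he γ hG (fun _ j => j)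
    (fun _ => le_rfl) (fun l => ?_) hK hδ0 hmod fun l j => ?_
  · exact Finset.sum_congr rfl fun j _ => congrArg _ (hw l j)
  · exact (le_of_eq (congrArg (· - δ) (hw l j))).trans ((hδ l j).trans_eq
      (decompositionOfFunctionals_subWeight_mul hω ψ hpos hzero hsum l j _).symm)

end

end States

/-! ### Positive matrices and the normalized trace -/

section Matrices

variable {n : Type*} [Fintype n] [DecidableEq n]

open scoped MatrixOrder in
theorem exists_eq_star_mul_self_of_posSemidef {A : Matrix n n ℂ} (hA : A.PosSemidef) :
    ∃ x, A = star x * x := by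
  refine ⟨CFC.sqrt A, ?_⟩
  rw [(CFC.sqrt_nonneg A).isSelfAdjoint.star_eq,
    CFC.sqrt_mul_sqrt_self A (Matrix.nonneg_iff_posSemidef.2 hA)]

theorem trace_mul_nonneg_of_posSemidef {A B : Matrix n n ℂ} (hA : A.PosSemidef)
    (hB : B.PosSemidef) : 0 ≤ (A * B).trace := by
  obtain ⟨x, rfl⟩ := exists_eq_star_mul_self_of_posSemidef hA
  rw [mul_assoc, Matrix.trace_mul_comm]
  exact (hB.mul_mul_conjTranspose_same x).trace_nonneg

variable {N : ℕ+}

theorem normalizedTrace_apply (A : Matrix (Fin N) (Fin N) ℂ) :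
    normalizedTrace N A = ((N : ℕ) : ℂ)⁻¹ * A.trace := rfl

theorem normalizedTrace_mul_comm (A B : Matrix (Fin N) (Fin N) ℂ) :
    normalizedTrace N (A * B) = normalizedTrace N (B * A) := by
  rw [normalizedTrace_apply, normalizedTrace_apply, Matrix.trace_mul_comm]

theorem natCast_inv_nonneg (N : ℕ+) : (0 : ℂ) ≤ ((N : ℕ) : ℂ)⁻¹ := by
  rw [← Complex.ofReal_natCast, ← Complex.ofReal_inv]
  exact Complex.zero_le_real.2 (by positivity)

theorem normalizedTrace_mul_nonneg {A B : Matrix (Fin N) (Fin N) ℂ} (hA : A.PosSemidef)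
    (hB : B.PosSemidef) : 0 ≤ normalizedTrace N (A * B) :=
  mul_nonneg (natCast_inv_nonneg N) (trace_mul_nonneg_of_posSemidef hA hB)

theorem normalizedTrace_mul_re_le {A B : Matrix (Fin N) (Fin N) ℂ} (hA : A.PosSemidef)
    (hB : (1 - B).PosSemidef) : (normalizedTrace N (A * B)).re ≤ (normalizedTrace N A).re := by
  have h := (Complex.le_def.1 (normalizedTrace_mul_nonneg hA hB)).1
  rw [mul_sub, mul_one, map_sub, Complex.sub_re, Complex.zero_re] at h
  linarith

theorem normalizedTrace_conj_unitary (A V : Matrix (Fin N) (Fin N) ℂ) (hV : V * Vᴴ = 1) :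
    normalizedTrace N (Vᴴ * A * V) = normalizedTrace N A := by
  rw [mul_assoc, normalizedTrace_mul_comm, mul_assoc, hV, mul_one]

theorem isState_normalizedTrace : IsState (normalizedTrace N) where
  nonneg x := by
    rw [normalizedTrace_apply]
    exact mul_nonneg (natCast_inv_nonneg N) (Matrix.posSemidef_conjTranspose_mul_self x).trace_nonneg
  map_one := by
    rw [normalizedTrace_apply, Matrix.trace_one, Fintype.card_fin]
    exact inv_mul_cancel₀ (Nat.cast_ne_zero.2 N.ne_zero)

theorem normalizedTrace_eq_zero_iff {A : Matrix (Fin N) (Fin N) ℂ} (hA : A.PosSemidef) :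
    normalizedTrace N A = 0 ↔ A = 0 := by
  rw [normalizedTrace_apply, mul_eq_zero, hA.trace_eq_zero_iff]
  exact or_iff_right (inv_ne_zero (Nat.cast_ne_zero.2 N.ne_zero))

end Matrices

/-! ### The positive-operator-valued measure of the coherent states -/

section CoherentMeasure

variable {X : Type*} [MetricSpace X] [MeasurableSpace X] {μ : Measure X}

/-- The operator `N ∫_S |C_N(x)⟩⟨C_N(x)| dμ(x)`, the anti-Wick quantization of the characteristic
function of `S`. -/
noncomputable def coherentMeasure (C : CoherentStates μ) (N : ℕ+) (S : Set X) :
    Matrix (Fin N) (Fin N) ℂ :=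
  Matrix.of fun i j => ((N : ℕ) : ℂ) * ∫ x in S, ketBra (C.vec N x) i j ∂μ

variable (C : CoherentStates μ) (N : ℕ+)

theorem coherentMeasure_univ : coherentMeasure C N Set.univ = 1 := by
  ext i j
  rw [← C.overcomplete N i j, coherentMeasure, Matrix.of_apply, Measure.restrict_univ]

theorem isHermitian_coherentMeasure (S : Set X) : (coherentMeasure C N S).IsHermitian := by
  ext i j
  rw [Matrix.conjTranspose_apply, coherentMeasure, Matrix.of_apply, Matrix.of_apply, star_mul',
    Complex.star_def, Complex.conj_natCast, ← integral_conj]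
  congr 2
  ext x
  simp [ketBra, mul_comm]

variable [IsFiniteMeasure μ]

theorem integrable_ketBra (i j : Fin N) : Integrable (fun x => ketBra (C.vec N x) i j) μ := by
  refine (integrable_mul_ketBra C N 1 i j).congr ?_
  filter_upwards [coeFn_one (μ := μ)] with x hx
  rw [hx, one_mul]

theorem antiWick_charFn {S : Set X} (hS : MeasurableSet S) :
    antiWick C N (charFn hS) = coherentMeasure C N S := by
  ext i j
  change ((N : ℕ) : ℂ) * _ = ((N : ℕ) : ℂ) * _
  congr 1
  rw [← integral_indicator hS]
  refine integral_congr_ae ?_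
  filter_upwards [coeFn_charFn (μ := μ) hS] with x hx
  rw [hx]
  by_cases h : x ∈ S <;> simp [h]

theorem coherentMeasure_biUnion {ι : Type*} (t : Finset ι) {S : ι → Set X}
    (hS : ∀ i ∈ t, MeasurableSet (S i)) (hd : (t : Set ι).Pairwise (Function.onFun Disjoint S)) :
    coherentMeasure C N (⋃ i ∈ t, S i) = ∑ i ∈ t, coherentMeasure C N (S i) := by
  ext a b
  rw [Matrix.sum_apply]
  simp only [coherentMeasure, Matrix.of_apply]
  rw [integral_biUnion_finset t hS hd fun i _ => (integrable_ketBra C N a b).integrableOn,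
    Finset.mul_sum]

theorem coherentMeasure_union {S S' : Set X} (hS' : MeasurableSet S') (hd : Disjoint S S') :
    coherentMeasure C N (S ∪ S') = coherentMeasure C N S + coherentMeasure C N S' := by
  ext a b
  rw [Matrix.add_apply]
  simp only [coherentMeasure, Matrix.of_apply]
  rw [setIntegral_union hd hS' (integrable_ketBra C N a b).integrableOn
    (integrable_ketBra C N a b).integrableOn, mul_add]

theorem one_sub_coherentMeasure {S : Set X} (hS : MeasurableSet S) :
    1 - coherentMeasure C N S = coherentMeasure C N Sᶜ := by
  rw [← coherentMeasure_univ C N, ← Set.union_compl_self S,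
    coherentMeasure_union C N hS.compl disjoint_compl_right, add_sub_cancel_left]

theorem trace_mul_coherentMeasure (A : Matrix (Fin N) (Fin N) ℂ) (S : Set X) :
    (A * coherentMeasure C N S).trace = ((N : ℕ) : ℂ) *
      ∫ x in S, star (C.vec N x : Fin N → ℂ) ⬝ᵥ A *ᵥ (C.vec N x : Fin N → ℂ) ∂μ := by
  have h : ∀ x, star (C.vec N x : Fin N → ℂ) ⬝ᵥ A *ᵥ (C.vec N x : Fin N → ℂ) =
      ∑ i, ∑ j, A i j * ketBra (C.vec N x) j i := fun x => by
    simp only [dotProduct, Matrix.mulVec, ketBra, Matrix.of_apply, Pi.star_apply, Finset.mul_sum]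
    exact Finset.sum_congr rfl fun i _ => Finset.sum_congr rfl fun j _ => by ring
  simp_rw [h]
  rw [integral_finsetSum _ fun i _ => integrable_finsetSum _ fun j _ =>
    ((integrable_ketBra C N j i).const_mul (A i j)).integrableOn]
  simp only [Matrix.trace, Matrix.diag_apply, Matrix.mul_apply, Finset.mul_sum]
  refine Finset.sum_congr rfl fun i _ => ?_
  rw [integral_finsetSum _ fun j _ =>
    ((integrable_ketBra C N j i).const_mul (A i j)).integrableOn, Finset.mul_sum]
  refine Finset.sum_congr rfl fun j _ => ?_
  rw [integral_const_mul, coherentMeasure, Matrix.of_apply]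
  ring

/-- The quadratic form of the quantization of `S` is the Husimi density `N |⟨w, C_N(x)⟩|²` integrated
over `S`. -/
theorem dotProduct_coherentMeasure_mulVec (w : EuclideanSpace ℂ (Fin N)) (S : Set X) :
    star (w : Fin N → ℂ) ⬝ᵥ coherentMeasure C N S *ᵥ (w : Fin N → ℂ) =
      ((∫ x in S, ((N : ℕ) : ℝ) * ‖inner ℂ w (C.vec N x)‖ ^ 2 ∂μ : ℝ) : ℂ) := by
  have h1 : star (w : Fin N → ℂ) ⬝ᵥ coherentMeasure C N S *ᵥ (w : Fin N → ℂ) =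
      (Matrix.vecMulVec (w : Fin N → ℂ) (star (w : Fin N → ℂ)) * coherentMeasure C N S).trace := by
    rw [Matrix.trace_mul_comm, Matrix.mul_vecMulVec, Matrix.trace_vecMulVec, dotProduct_comm]
  rw [h1, trace_mul_coherentMeasure, ← integral_complex_ofReal, ← integral_const_mul]
  congr 1
  ext x
  rw [Matrix.vecMulVec_mulVec, dotProduct_smul, EuclideanSpace.inner_eq_star_dotProduct]
  push_cast
  rw [← Complex.mul_conj', ← Complex.star_def, op_smul_eq_mul, Matrix.star_dotProduct,
    dotProduct_comm (star _), mul_comm (star _)]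

theorem posSemidef_coherentMeasure (S : Set X) : (coherentMeasure C N S).PosSemidef := by
  refine .of_dotProduct_mulVec_nonneg (isHermitian_coherentMeasure C N S) fun w => ?_
  rw [← WithLp.ofLp_toLp 2 w, dotProduct_coherentMeasure_mulVec]
  exact Complex.zero_le_real.2 (integral_nonneg fun x => by positivity)

theorem normalizedTrace_coherentMeasure (S : Set X) :
    normalizedTrace N (coherentMeasure C N S) = ((μ.real S : ℝ) : ℂ) := by
  have h : ∀ x, star (C.vec N x : Fin N → ℂ) ⬝ᵥ
      (1 : Matrix (Fin N) (Fin N) ℂ) *ᵥ (C.vec N x : Fin N → ℂ) = 1 := fun x => by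
    rw [Matrix.one_mulVec, dotProduct_comm, ← EuclideanSpace.inner_eq_star_dotProduct,
      inner_self_eq_norm_sq_to_K, C.normalized]
    simp
  rw [normalizedTrace_apply, ← one_mul (coherentMeasure C N S), trace_mul_coherentMeasure]
  simp_rw [h]
  rw [inv_mul_cancel_left₀ (Nat.cast_ne_zero.2 N.ne_zero), setIntegral_const]
  simp

/-- The trace of the quantization of `S'` against that of `S`, moved by `V`, is a double integral of
overlaps `N |⟨V C(x), C(y)⟩|²`; it is small if the overlaps are. -/
theorem normalizedTrace_mul_conj_re_le [IsProbabilityMeasure μ] (V : Matrix (Fin N) (Fin N) ℂ)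
    (S S' : Set X) {ε : ℝ} (hε : 0 ≤ ε) (h : ∀ x ∈ S', ∀ y ∈ S, ((N : ℕ) : ℝ) *
      ‖inner ℂ (Matrix.toEuclideanLin V (C.vec N x)) (C.vec N y)‖ ^ 2 ≤ ε) :
    (normalizedTrace N (coherentMeasure C N S' * (Vᴴ * coherentMeasure C N S * V))).re ≤ ε := by
  have h1 : ∀ x, star (C.vec N x : Fin N → ℂ) ⬝ᵥ
      (Vᴴ * coherentMeasure C N S * V) *ᵥ (C.vec N x : Fin N → ℂ) =
      ((∫ y in S, ((N : ℕ) : ℝ) *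
        ‖inner ℂ (Matrix.toEuclideanLin V (C.vec N x)) (C.vec N y)‖ ^ 2 ∂μ : ℝ) : ℂ) := by
    intro x
    rw [← dotProduct_coherentMeasure_mulVec, Matrix.ofLp_toLpLin, Matrix.toLin'_apply,
      Matrix.star_mulVec, ← Matrix.mulVec_mulVec, ← Matrix.mulVec_mulVec, Matrix.dotProduct_mulVec]
  rw [normalizedTrace_mul_comm, normalizedTrace_apply, trace_mul_coherentMeasure,
    inv_mul_cancel_left₀ (Nat.cast_ne_zero.2 N.ne_zero)]
  refine (Complex.re_le_norm _).trans ((norm_setIntegral_le_of_norm_le_const (C := ε)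
    (measure_lt_top μ S') fun x hx => ?_).trans (mul_le_of_le_one_right hε measureReal_le_one))
  rw [h1, Complex.norm_real]
  refine (norm_setIntegral_le_of_norm_le_const (C := ε) (measure_lt_top μ S) fun y hy => ?_).trans
    (mul_le_of_le_one_right hε measureReal_le_one)
  rw [Real.norm_of_nonneg (by positivity)]
  exact h x hx y hy

end CoherentMeasure

/-! ### The evolved coherent states -/

section Evolution

variable {X : Type*} [MetricSpace X] [MeasurableSpace X] {μ : Measure X} (C : CoherentStates μ)
  {N : ℕ+} (V : Matrix (Fin N) (Fin N) ℂ)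

/-- The operator `V* (N ∫_S |C_N(x)⟩⟨C_N(x)| dμ(x)) V`. -/
noncomputable def evolvedMeasure (S : Set X) : Matrix (Fin N) (Fin N) ℂ :=
  Vᴴ * coherentMeasure C N S * V

theorem quantumDynamics_pow_apply (U : Matrix.unitaryGroup (Fin N) ℂ) (l : ℕ)
    (x : Matrix (Fin N) (Fin N) ℂ) :
    (quantumDynamics U ^ l) x =
      ((U : Matrix (Fin N) (Fin N) ℂ) ^ l)ᴴ * x * (U : Matrix (Fin N) (Fin N) ℂ) ^ l := by
  induction l with
  | zero => simp
  | succ l ih =>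
    rw [pow_succ', StarAlgEquiv.mul_apply, ih, quantumDynamics_apply, pow_succ,
      Matrix.conjTranspose_mul]
    simp only [mul_assoc]

theorem pow_mul_conjTranspose_pow (U : Matrix.unitaryGroup (Fin N) ℂ) (l : ℕ) :
    (U : Matrix (Fin N) (Fin N) ℂ) ^ l * ((U : Matrix (Fin N) (Fin N) ℂ) ^ l)ᴴ = 1 :=
  Matrix.mem_unitaryGroup_iff.1 (U ^ l).2

variable [IsFiniteMeasure μ]

theorem quantizedPartition_atomFn (U : (N : ℕ+) → Matrix.unitaryGroup (Fin N) ℂ) {q : ℕ}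
    {P : Fin q → Set X} (hP : IsMeasurablePartition P) (l : ℕ) (m : Fin q) :
    quantizedPartition C U hP N l (atomFn μ hP m) =
      evolvedMeasure C ((U N : Matrix (Fin N) (Fin N) ℂ) ^ l) (P m) := by
  rw [evolvedMeasure, ← quantumDynamics_pow_apply, ← antiWick_charFn C N (hP.measurableSet m)]
  rfl

theorem posSemidef_evolvedMeasure (S : Set X) : (evolvedMeasure C V S).PosSemidef :=
  (posSemidef_coherentMeasure C N S).conjTranspose_mul_mul_same V

theorem evolvedMeasure_union {S S' : Set X} (hS' : MeasurableSet S') (hd : Disjoint S S') :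
    evolvedMeasure C V (S ∪ S') = evolvedMeasure C V S + evolvedMeasure C V S' := by
  rw [evolvedMeasure, coherentMeasure_union C N hS' hd, mul_add, add_mul]
  rfl

variable {V} (hV : V * Vᴴ = 1)
include hV

theorem one_sub_evolvedMeasure {S : Set X} (hS : MeasurableSet S) :
    1 - evolvedMeasure C V S = evolvedMeasure C V Sᶜ := by
  have h : Vᴴ * V = 1 := mul_eq_one_comm.1 hV
  rw [evolvedMeasure, evolvedMeasure, ← one_sub_coherentMeasure C N hS, mul_sub, sub_mul, mul_one,
    h]

theorem normalizedTrace_evolvedMeasure (S : Set X) :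
    normalizedTrace N (evolvedMeasure C V S) = ((μ.real S : ℝ) : ℂ) := by
  rw [evolvedMeasure, normalizedTrace_conj_unitary _ _ hV, normalizedTrace_coherentMeasure]

end Evolution

section Localization

variable {X : Type*} [MetricSpace X] [CompactSpace X] [MeasurableSpace X] [BorelSpace X]
  {μ : Measure X} [IsProbabilityMeasure μ]

/-- A measurable set and its complement contain closed sets of almost full measure, which lie at
positive distance from each other by compactness. -/
theorem exists_isClosed_pair {S : Set X} (hS : MeasurableSet S) {δ : ℝ} (hδ : 0 < δ) :
    ∃ K K' : Set X, K ⊆ S ∧ K' ⊆ Sᶜ ∧ IsClosed K ∧ IsClosed K' ∧ μ.real (S \ K) ≤ δ ∧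
      μ.real (Sᶜ \ K') ≤ δ ∧ ∃ d > (0 : ℝ), ∀ x ∈ K, ∀ y ∈ K', d ≤ dist x y := by
  have hδ' : ENNReal.ofReal δ ≠ 0 := by simpa using hδ
  obtain ⟨K, hKS, hK, hμK⟩ := hS.exists_isClosed_sdiff_lt (measure_ne_top μ S) hδ'
  obtain ⟨K', hKS', hK', hμK'⟩ := hS.compl.exists_isClosed_sdiff_lt (measure_ne_top μ Sᶜ) hδ'
  have hd : Disjoint K K' := (disjoint_compl_right (a := S)).mono hKS hKS'
  obtain ⟨r, hr, h⟩ := Metric.exists_pos_forall_lt_edist hK.isCompact hK' hd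
  refine ⟨K, K', hKS, hKS', hK, hK', ENNReal.toReal_le_of_le_ofReal hδ.le hμK.le,
    ENNReal.toReal_le_of_le_ofReal hδ.le hμK'.le, r, hr, fun x hx y hy => ?_⟩
  have h1 := h x hx y hy
  rw [edist_nndist, ENNReal.coe_lt_coe] at h1
  exact_mod_cast h1.le

variable {T : X → X} (hT : MeasurePreserving T μ μ) (C : CoherentStates μ)
  (U : (N : ℕ+) → Matrix.unitaryGroup (Fin N) ℂ)
include hT

/-- Egorov property on the logarithmic time scale: the evolved quantization of `S` almost coincides
with the quantization of `T⁻ᵏ S`, uniformly in `k ≤ α log N`. The set `S` and its complement are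
replaced by closed subsets at positive distance, where localization applies pointwise; what is left
out is small in measure, uniformly in `k` as `T` preserves `μ`. -/
theorem exists_forall_le_normalizedTrace_mul_evolvedMeasure {α : ℝ}
    (hα : ∀ ε > (0 : ℝ), ∀ d₀ > (0 : ℝ), ∃ N₀ : ℕ, ∀ N : ℕ+, N₀ < (N : ℕ) →
      ∀ k : ℕ, (k : ℝ) ≤ α * Real.log (N : ℕ) → ∀ x y, d₀ ≤ dist (T^[k] x) y →
      ((N : ℕ) : ℝ) * ‖inner ℂ
        (Matrix.toEuclideanLin ((U N : Matrix (Fin N) (Fin N) ℂ) ^ k) (C.vec N x))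
        (C.vec N y)‖ ^ 2 ≤ ε) {S : Set X} (hS : MeasurableSet S) {δ : ℝ} (hδ : 0 < δ) :
    ∃ N₀ : ℕ, ∀ N : ℕ+, N₀ < (N : ℕ) → ∀ k : ℕ, (k : ℝ) ≤ α * Real.log (N : ℕ) →
      μ.real S - δ ≤ (normalizedTrace N (coherentMeasure C N (T^[k] ⁻¹' S) *
        evolvedMeasure C ((U N : Matrix (Fin N) (Fin N) ℂ) ^ k) S)).re := by
  have hδ3 : 0 < δ / 3 := by positivity
  obtain ⟨K, K', hKS, hKS', hK, hK', hμK, hμK', d, hd, hdist⟩ :=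
    exists_isClosed_pair (μ := μ) hS hδ3
  obtain ⟨N₀, hN₀⟩ := hα (δ / 3) hδ3 d hd
  refine ⟨N₀, fun N hN k hk => ?_⟩
  have hV := pow_mul_conjTranspose_pow (U N) k
  set V := (U N : Matrix (Fin N) (Fin N) ℂ) ^ k with hVdef
  have hTk := hT.iterate k
  have hpre : ∀ A, MeasurableSet A → μ.real (T^[k] ⁻¹' A) = μ.real A := fun A hA => by
    rw [measureReal_def, hTk.measure_preimage hA.nullMeasurableSet, measureReal_def]
  set F := fun A => coherentMeasure C N (T^[k] ⁻¹' A) with hF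
  set E := evolvedMeasure C V with hE
  have hτF : ∀ A, MeasurableSet A → (normalizedTrace N (F A)).re = μ.real A := fun A hA => by
    rw [hF, normalizedTrace_coherentMeasure, Complex.ofReal_re, hpre A hA]
  have hFS : F S = F K + F (S \ K) := by
    have h := coherentMeasure_union C N (S := T^[k] ⁻¹' K)
      (hTk.measurable (hS.diff hK.measurableSet)) (disjoint_sdiff_self_right.preimage _)
    rwa [← Set.preimage_union, Set.union_sdiff_cancel hKS] at h
  have hES : E Sᶜ = E K' + E (Sᶜ \ K') := by
    rw [hE, ← evolvedMeasure_union C V (hS.compl.diff hK'.measurableSet) disjoint_sdiff_self_right,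
      Set.union_sdiff_cancel hKS']
  have h1 : (normalizedTrace N (F K * E K')).re ≤ δ / 3 :=
    normalizedTrace_mul_conj_re_le C N V K' (T^[k] ⁻¹' K) hδ3.le fun x hx y hy =>
      hN₀ N hN k hk x y (hdist _ hx y hy)
  have h2 : (normalizedTrace N (F K * E (Sᶜ \ K'))).re ≤ δ / 3 := by
    rw [normalizedTrace_mul_comm]
    refine (normalizedTrace_mul_re_le (posSemidef_evolvedMeasure C V _) ?_).trans ?_
    · rw [hF, one_sub_coherentMeasure C N (hTk.measurable hK.measurableSet)]
      exact posSemidef_coherentMeasure C N _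
    · rw [normalizedTrace_evolvedMeasure C hV, Complex.ofReal_re]
      exact hμK'
  have h3 : (normalizedTrace N (F (S \ K) * E Sᶜ)).re ≤ δ / 3 := by
    refine (normalizedTrace_mul_re_le (posSemidef_coherentMeasure C N _) ?_).trans ?_
    · rw [hE, one_sub_evolvedMeasure C hV hS.compl]
      exact posSemidef_evolvedMeasure C V _
    · exact (hτF _ (hS.diff hK.measurableSet)).trans_le hμK
  have h4 : (normalizedTrace N (F S * E Sᶜ)).re ≤ δ := by
    rw [hFS, add_mul, map_add, Complex.add_re]
    conv_lhs => enter [1]; rw [hES, mul_add, map_add, Complex.add_re]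
    linarith
  rw [hE, ← one_sub_evolvedMeasure C hV hS, mul_sub, mul_one, map_sub, Complex.sub_re,
    hτF S hS] at h4
  change μ.real S - δ ≤ (normalizedTrace N (F S * evolvedMeasure C V S)).re
  linarith

end Localization

/-! ### Comparison of the quantum and the classical entropy -/

section Comparison

variable {X : Type*} [MeasurableSpace X] {μ : Measure X} {T : X → X} {q : ℕ} {P : Fin q → Set X}
  (hP : IsMeasurablePartition P)

/-- An atom `⋂ l, T^{-l}(P_{b l})` of the refined partition. -/
def refinedAtom (T : X → X) (P : Fin q → Set X) {k : ℕ} (b : Fin k → Fin q) : Set X :=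
  ⋂ l : Fin k, T^[l] ⁻¹' P (b l)

theorem measurableSet_refinedAtom (hP : IsMeasurablePartition P) (hT : Measurable T) {k : ℕ}
    (b : Fin k → Fin q) : MeasurableSet (refinedAtom T P b) :=
  MeasurableSet.iInter fun l => hT.iterate l (hP.measurableSet _)

theorem disjoint_refinedAtom (hP : IsMeasurablePartition P) {k : ℕ} {b b' : Fin k → Fin q}
    (h : b ≠ b') : Disjoint (refinedAtom T P b) (refinedAtom T P b') := by
  obtain ⟨l, hl⟩ := Function.ne_iff.1 h
  exact ((hP.disjoint _ _ hl).preimage T^[l]).mono (Set.iInter_subset _ l) (Set.iInter_subset _ l)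

theorem exists_mem_refinedAtom (hP : IsMeasurablePartition P) (k : ℕ) (x : X) :
    ∃ b : Fin k → Fin q, x ∈ refinedAtom T P b := by
  have h : ∀ y, ∃ m, y ∈ P m := fun y =>
    Set.mem_iUnion.1 (hP.iUnion_eq.symm ▸ Set.mem_univ y : y ∈ ⋃ i, P i)
  choose f hf using h
  exact ⟨fun l => f (T^[l] x), Set.mem_iInter.2 fun l => hf _⟩

variable [MetricSpace X] [IsFiniteMeasure μ] (C : CoherentStates μ) (N : ℕ+)

theorem sum_coherentMeasure_refinedAtom (hP : IsMeasurablePartition P) (hT : Measurable T) {k : ℕ}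
    (l : Fin k) (m : Fin q) :
    ∑ b with b l = m, coherentMeasure C N (refinedAtom T P b) =
      coherentMeasure C N (T^[l] ⁻¹' P m) := by
  rw [← coherentMeasure_biUnion C N _ (fun b _ => measurableSet_refinedAtom hP hT b)
    fun b _ b' _ h => disjoint_refinedAtom hP h]
  congr 1
  ext x
  simp only [Set.mem_iUnion, Finset.mem_filter, Finset.mem_univ, true_and, exists_prop]
  constructor
  · rintro ⟨b, rfl, hb⟩
    exact Set.mem_iInter.1 hb l
  · intro hx
    obtain ⟨b, hb⟩ := exists_mem_refinedAtom (T := T) hP k x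
    refine ⟨b, ?_, hb⟩
    by_contra hne
    exact Set.disjoint_left.1 (hP.disjoint _ _ hne) (Set.mem_iInter.1 hb l) hx

theorem isPOVM_coherentMeasure_refinedAtom (hP : IsMeasurablePartition P) (hT : Measurable T)
    (k : ℕ) : IsPOVM fun b : Fin k → Fin q => coherentMeasure C N (refinedAtom T P b) where
  pos b := exists_eq_star_mul_self_of_posSemidef (posSemidef_coherentMeasure C N _)
  sum_eq_one := by
    have h := coherentMeasure_biUnion C N Finset.univ
      (fun b _ => measurableSet_refinedAtom (k := k) hP hT b)
      fun b _ b' _ h => disjoint_refinedAtom hP h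
    rw [← h, ← coherentMeasure_univ C N]
    congr 1
    ext x
    simpa using exists_mem_refinedAtom hP k x

theorem sum_coherentMeasure_preimage (hP : IsMeasurablePartition P) {f : X → X}
    (hf : Measurable f) : ∑ m, coherentMeasure C N (f ⁻¹' P m) = 1 := by
  rw [← coherentMeasure_biUnion C N _ (fun m _ => hf (hP.measurableSet m))
    fun m _ m' _ h => (hP.disjoint _ _ h).preimage f, ← coherentMeasure_univ C N]
  congr 1
  rw [← Set.preimage_univ (f := f), ← hP.iUnion_eq]
  ext x
  simp

/-- The finite-dimensional comparison. With the fixed error `ε + K t²` in the continuity of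
`-t log t` and defect `δ` in the Egorov property, the functional differs from the classical entropy
by at most a constant times `k`. -/
theorem abs_subalgebraFunctional_sub_refinedEntropy_le (hT : MeasurePreserving T μ μ)
    (U : (N : ℕ+) → Matrix.unitaryGroup (Fin N) ℂ) {k : ℕ} {ε K δ : ℝ} (hε : 0 ≤ ε) (hK : 0 ≤ K)
    (hδ0 : 0 ≤ δ) (hmod : ∀ s ∈ Set.Icc (0 : ℝ) 1, ∀ t ∈ Set.Icc (0 : ℝ) 1,
      |Real.negMulLog s - Real.negMulLog t| ≤ ε + K * (s - t) ^ 2)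
    (hδ : ∀ (l : Fin k) m, μ.real (P m) - δ ≤ (normalizedTrace N
      (coherentMeasure C N (T^[l] ⁻¹' P m) *
        evolvedMeasure C ((U N : Matrix (Fin N) (Fin N) ℂ) ^ (l : ℕ)) (P m))).re) :
    |subalgebraFunctional (normalizedTrace N) (fun l : Fin k => quantizedPartition C U hP N l)
      - refinedEntropy μ T P k| ≤ k * (q * (2 * ε) + K * (2 * q + q * q) * δ) := by
  set γ := fun l : Fin k => quantizedPartition C U hP N l with hγ
  set F := fun (l : Fin k) m => coherentMeasure C N (T^[l] ⁻¹' P m) with hF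
  set Y := fun b : Fin k → Fin q => coherentMeasure C N (refinedAtom T P b) with hYdef
  have hGE : ∀ l m, γ l (atomFn μ hP m) =
      evolvedMeasure C ((U N : Matrix (Fin N) (Fin N) ℂ) ^ (l : ℕ)) (P m) := fun l m =>
    quantizedPartition_atomFn C U hP l m
  have hV := pow_mul_conjTranspose_pow (U N)
  have he := vonNeumannEntropy_partitionAlgebra (μ := μ) hP
  have hY : IsPOVM Y := isPOVM_coherentMeasure_refinedAtom C N hP hT.measurable k
  have hYF : ∀ l m, ∑ b with b l = m, Y b = F l m := fun l m =>
    sum_coherentMeasure_refinedAtom C N hP hT.measurable l m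
  have hFpos : ∀ l m, (F l m).PosSemidef := fun l m => posSemidef_coherentMeasure C N _
  have hFsum : ∀ l, IsPOVM (F l) := fun l =>
    ⟨fun m => exists_eq_star_mul_self_of_posSemidef (hFpos l m),
      sum_coherentMeasure_preimage C N hP (hT.measurable.iterate l)⟩
  have hGpos : ∀ l m, (γ l (atomFn μ hP m)).PosSemidef := fun l m => by
    rw [hGE]
    exact posSemidef_evolvedMeasure C _ _
  have hG : ∀ l, IsPOVM fun m => γ l (atomFn μ hP m) := fun l => by
    refine ⟨fun m => exists_eq_star_mul_self_of_posSemidef (hGpos l m), ?_⟩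
    simp_rw [hGE, evolvedMeasure]
    rw [← Finset.sum_mul, ← Finset.mul_sum]
    have h := sum_coherentMeasure_preimage C N hP measurable_id
    simp only [Set.preimage_id] at h
    rw [h, mul_one]
    exact mul_eq_one_comm.1 (hV l)
  have hτY : ∀ b, (normalizedTrace N (Y b)).re = μ.real (refinedAtom T P b) := fun b => by
    rw [hYdef, normalizedTrace_coherentMeasure, Complex.ofReal_re]
  have hτF : ∀ l m, (normalizedTrace N (F l m)).re = μ.real (P m) := fun l m => by
    rw [hF, normalizedTrace_coherentMeasure, Complex.ofReal_re, measureReal_def,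
      (hT.iterate l).measure_preimage (hP.measurableSet m).nullMeasurableSet, measureReal_def]
  have hτG : ∀ l m, (normalizedTrace N (γ l (atomFn μ hP m))).re = μ.real (P m) := fun l m => by
    rw [hGE, normalizedTrace_evolvedMeasure C (hV l), Complex.ofReal_re]
  have hδ' : ∀ l m, μ.real (P m) - δ ≤
      (normalizedTrace N (F l m * γ l (atomFn μ hP m))).re := fun l m => by
    rw [hGE]
    exact hδ l m
  have hent : refinedEntropy μ T P k = ∑ b, Real.negMulLog (normalizedTrace N (Y b)).re := by
    simp_rw [hτY]
    rfl
  -- both quantizations have second moment at most `μ(P m)`, and overlap at least `μ(P m) - δ`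
  have hsq : ∀ l m, (normalizedTrace N ((γ l (atomFn μ hP m) - F l m) *
      (γ l (atomFn μ hP m) - F l m))).re ≤ 2 * δ := by
    intro l m
    have h1 := normalizedTrace_mul_re_le (hFpos l m) (B := F l m) (by
      rw [hF, one_sub_coherentMeasure C N (hT.measurable.iterate l (hP.measurableSet m))]
      exact posSemidef_coherentMeasure C N _)
    have h2 := normalizedTrace_mul_re_le (hGpos l m) (B := γ l (atomFn μ hP m)) (by
      rw [hGE, one_sub_evolvedMeasure C (hV l) (hP.measurableSet m)]
      exact posSemidef_evolvedMeasure C _ _)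
    have h3 := hδ' l m
    have h4 := normalizedTrace_mul_comm (γ l (atomFn μ hP m)) (F l m)
    rw [hτF] at h1
    rw [hτG] at h2
    rw [mul_sub, sub_mul, sub_mul, map_sub, map_sub, map_sub, h4]
    simp only [Complex.sub_re]
    linarith
  have hup : ∀ D : StateDecomposition (normalizedTrace N) k,
      D.value γ ≤ refinedEntropy μ T P k + k * (q * (ε + K * (2 * δ))) := by
    intro D
    rw [hent]
    refine D.value_le he γ hY hFsum hYF hG (fun l m => ?_) (fun l m => ?_) hK hmod hsq
    · rw [star_sub, Matrix.star_eq_conjTranspose, Matrix.star_eq_conjTranspose,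
        (hGpos l m).isHermitian.eq, (hFpos l m).isHermitian.eq]
    · rw [hτF, hτG]
  -- the decomposition of the trace by the POVM of the refined partition
  set ψ : (Fin k → Fin q) → Matrix (Fin N) (Fin N) ℂ →ₗ[ℂ] ℂ := fun b =>
    normalizedTrace N ∘ₗ LinearMap.mulLeft ℂ (Y b) with hψ
  have hψa : ∀ b x, ψ b x = normalizedTrace N (Y b * x) := fun b x => rfl
  have hYpos : ∀ b, (Y b).PosSemidef := fun b => posSemidef_coherentMeasure C N _
  have hpos : ∀ b x, 0 ≤ ψ b (star x * x) := fun b x =>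
    normalizedTrace_mul_nonneg (hYpos b) (Matrix.posSemidef_conjTranspose_mul_self x)
  have hzero : ∀ b, ψ b 1 = 0 → ψ b = 0 := fun b h => by
    rw [hψa, mul_one, normalizedTrace_eq_zero_iff (hYpos b)] at h
    ext1 x
    rw [hψa, h, zero_mul, map_zero, LinearMap.zero_apply]
  have hsum : ∑ b, ψ b = normalizedTrace N := by
    ext1 x
    rw [LinearMap.sum_apply]
    simp_rw [hψa]
    rw [← map_sum, ← Finset.sum_mul, hY.sum_eq_one, one_mul]
  have hψm : ∀ (l : Fin k) m x, ∑ b with b l = m, ψ b x = normalizedTrace N (F l m * x) :=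
    fun l m x => by
      simp_rw [hψa]
      rw [← map_sum, ← Finset.sum_mul, hYF]
  have hlow := le_value_decompositionOfFunctionals isState_normalizedTrace ψ hpos hzero hsum he γ hG
    (fun l j => by rw [hψm, mul_one, hτF, hτG]) hK hδ0 hmod fun l j => by
      rw [hψm, hτG]
      exact hδ' l j
  have hψ1 : ∀ b, ψ b 1 = normalizedTrace N (Y b) := fun b => by rw [hψa, mul_one]
  simp_rw [hψ1] at hlow
  rw [← hent] at hlow
  have hbdd : BddAbove (Set.range fun D : StateDecomposition (normalizedTrace N) k => D.value γ) :=
    ⟨_, Set.forall_mem_range.2 hup⟩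
  have : Nonempty (StateDecomposition (normalizedTrace N) k) :=
    ⟨decompositionOfFunctionals isState_normalizedTrace ψ hpos hzero hsum⟩
  have h1 : subalgebraFunctional (normalizedTrace N) γ ≤ _ := ciSup_le hup
  have h2 : _ ≤ subalgebraFunctional (normalizedTrace N) γ := hlow.trans (le_ciSup hbdd _)
  have h3 : 0 ≤ (k : ℝ) * (q * ε) := by positivity
  have h4 : 0 ≤ (k : ℝ) * (K * q * δ) := by positivity
  have h5 : 0 ≤ (k : ℝ) * (K * q * q * δ) := by positivity
  rw [abs_le]
  constructor <;> linarith

end Comparison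

end CNT

theorem mainTheorem1 {X : Type*} [MetricSpace X] [CompactSpace X] [MeasurableSpace X]
    [BorelSpace X] (μ : Measure X) [IsProbabilityMeasure μ]
    (T : X ≃ᵐ X) (hT : MeasurePreserving T μ μ)
    (C : CNT.CoherentStates μ) (U : (N : ℕ+) → Matrix.unitaryGroup (Fin N) ℂ)
    (hloc : CNT.DynamicalLocalization T C U)
    {q : ℕ} (P : Fin q → Set X) (hP : CNT.IsMeasurablePartition P) :
    ∃ α > (0 : ℝ), Tendsto
      (fun p : ℕ × ℕ+ => (1 / (p.1 : ℝ)) *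
        |CNT.subalgebraFunctional (CNT.normalizedTrace p.2)
            (fun l : Fin p.1 => CNT.quantizedPartition C U hP p.2 l)
          - CNT.refinedEntropy μ T P p.1|)
      ((atTop ×ˢ atTop) ⊓ 𝓟 {p : ℕ × ℕ+ | (p.1 : ℝ) ≤ α * Real.log ((p.2 : ℕ) : ℝ)})
      (𝓝 0) := by
  obtain ⟨α, hα, hloc⟩ := hloc
  refine ⟨α, hα, ?_⟩
  rw [Metric.tendsto_nhds]
  intro r hr
  -- `ε` and `δ` make the error per step, `q * (2 * ε) + K * (2 * q + q * q) * δ`, less than `r`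
  have hε : 0 < r / (4 * (q + 1)) := by positivity
  obtain ⟨K, hK, hmod⟩ := CNT.exists_abs_negMulLog_sub_le hε
  have hL : 0 ≤ K * (2 * q + q * q) := by positivity
  have hδ : 0 < r / (4 * (K * (2 * q + q * q) + 1)) := by positivity
  choose N₀ hN₀ using fun m => CNT.exists_forall_le_normalizedTrace_mul_evolvedMeasure hT C U hloc
    (hP.measurableSet m) hδ
  have hN : ∀ᶠ N : ℕ+ in atTop, ∀ m, N₀ m < (N : ℕ) :=
    eventually_all.2 fun m => (eventually_ge_atTop (N₀ m).succPNat).mono fun N h =>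
      Nat.succ_le_iff.1 (PNat.coe_le_coe _ _ |>.2 h)
  rw [eventually_inf_principal]
  filter_upwards [(eventually_ge_atTop 1).prod_mk hN] with p hp hpα
  obtain ⟨hk, hN⟩ := hp
  have hk0 : (0 : ℝ) < p.1 := by exact_mod_cast hk
  have h := CNT.abs_subalgebraFunctional_sub_refinedEntropy_le hP C p.2 hT U (k := p.1) hε.le hK
    hδ.le hmod fun l m => hN₀ m p.2 (hN m) l
      ((Nat.cast_le.2 l.2.le).trans hpα)
  rw [dist_zero_right, Real.norm_of_nonneg (by positivity), one_div, inv_mul_lt_iff₀ hk0]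
  refine h.trans_lt (mul_lt_mul_of_pos_left ?_ hk0)
  have h1 : (q : ℝ) * (2 * (r / (4 * (q + 1)))) ≤ r / 2 := by
    rw [← mul_assoc, mul_div_assoc', div_le_div_iff₀ (by positivity) (by positivity)]
    nlinarith
  have h2 : K * (2 * q + q * q) * (r / (4 * (K * (2 * q + q * q) + 1))) ≤ r / 4 := by
    rw [mul_div_assoc', div_le_div_iff₀ (by positivity) (by positivity)]
    nlinarith
  linarith
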